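/- Let $T$ be $[0,\infty)$ or $\{0,1,\dots,N\}$, and let $\mathbb{X}=(X_t)_{t\in T}$ be a finite filtration of a Hausdorff space's subspaces: $X_0=\emptyset$, $X_s\subset X_t$ for $s\le t$, the union $X=\bigcup_t X_t$ is a finite CW complex (for example a finite simplicial or cubical complex), each $X_t$ is a subcomplex of it, and the filtration is a right-continuous step function of $t$, i.e. there are $0=r_0<r_1<\dots<r_M<r_{M+1}=\infty$ such that $X_t=X_{r_k}$ whenever $t\in T$ and $r_k\le t<r_{k+1}$ (this last condition is automatic when $T=\{0,\dots,N\}$). For a field $\Bbbk$ and $q\ge 0$, let $D_q(\mathbb{X};\Bbbk)$ be the $q$-th persistence diagram: the multiset of the pairs $(b,d)$, with $b\in T$, $d\in T\cup\{\infty\}$, $b<d$, such that the persistent homology $\bigl(H_q(X_t;\Bbbk)\bigr)_{t\in T}$ is isomorphic to the direct sum of the corresponding interval modules $I(b,d)$ (equal to $\Bbbk$ for $b\le t<d$, with identity maps, and to $0$ otherwise). Assume that $H_q(X_t;\mathbb{Z})$ and $H_{q-1}(X_t;\mathbb{Z})$ are free for all $t\in T$ (where $H_{-1}=0$) and that $H_q(X;\mathbb{Z})=0$.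 Let $p$ be a prime. Then all death times in $D_q(\mathbb{X};\mathbb{R})$ and $D_q(\mathbb{X};\mathbb{Z}_p)$ are finite, and for every $C^2$ convex function $f$ on $[0,\infty)$ with $f(0)=0$, $$\sum_{(b,d)\in D_q(\mathbb{X};\mathbb{R})} f(d-b)\ \ge \sum_{(b,d)\in D_q(\mathbb{X};\mathbb{Z}_p)} f(d-b).$$ When $f$ is strictly convex, equality holds if and only if $D_q(\mathbb{X};\mathbb{R})=D_q(\mathbb{X};\mathbb{Z}_p)$. Moreover, for every real $r>1$, $$W_r\bigl(D_q(\mathbb{X};\mathbb{R}),\emptyset\bigr)\ \ge\ W_r\bigl(D_q(\mathbb{X};\mathbb{Z}_p),\emptyset\bigr),$$ where $W_r$ is the $r$-Wasserstein distance of persistence diagrams, $W_r(D,D')=\inf_\gamma\bigl(\sum_x\|x-\gamma(x)\|_\infty^r\bigr)^{1/r}$, the infimum being over all bijections $\gamma$ from $D$ to $D'$, each augmented by the points of the diagonal with infinite multiplicity. -/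

import Mathlib

open CategoryTheory Set
open scoped ENNReal

noncomputable section

namespace PersistentHomology

universe u

/-- The two kinds of index sets: `ℝ_+ = [0, ∞)` and `{0, 1, …, N}`. -/
def IsTimeSet (T : Set ℝ) : Prop :=
  T = Ici 0 ∨ ∃ N : ℕ, T = {x : ℝ | ∃ n : ℕ, n ≤ N ∧ x = (n : ℝ)}

/-- A finite filtration, indexed by `T`, of subspaces of a space `Y`: an increasing family
starting with the empty set, whose union is a finite CW complex (which includes finite simplicial
and cubical complexes), whose members are subcomplexes, and which is a right-continuous step
function of the parameter. -/
structure FiniteFiltration (T : Set ℝ) (Y : Type u) [TopologicalSpace Y] where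
  /-- the spaces `X_t` of the filtration -/
  space : T → Set Y
  mono : Monotone space
  empty_of_eq_zero : ∀ t : T, (t : ℝ) = 0 → space t = ∅
  finite_complex : ∃ _ : Topology.CWComplex (⋃ t, space t),
    Topology.CWComplex.Finite (⋃ t, space t) ∧
    ∀ t, ∃ E : Topology.CWComplex.Subcomplex (⋃ t, space t), (E : Set Y) = space t
  /-- there are finitely many critical values, and the filtration does not change from time `s` to
  time `t` if there is no critical value `c` with `s < c ≤ t` -/
  step : ∃ S : Finset ℝ, ∀ s t : T, s ≤ t →
    (∀ c ∈ S, ¬ ((s : ℝ) < c ∧ c ≤ (t : ℝ))) → space s = space t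

namespace FiniteFiltration

variable {T : Set ℝ} {Y : Type u} [TopologicalSpace Y]

/-- The total space `⋃ t, X_t`. -/
def total (X : FiniteFiltration T Y) : Set Y := ⋃ t, X.space t

/-- The filtration as a diagram of topological spaces and inclusion maps. -/
def toFunctor (X : FiniteFiltration T Y) : T ⥤ TopCat.{u} where
  obj t := TopCat.of (X.space t)
  map h := TopCat.ofHom ⟨Set.inclusion (X.mono (leOfHom h)), continuous_inclusion _⟩

end FiniteFiltration

/-- Singular homology `H_q(-; k)` with coefficients in the ring `k`. -/
def singularHomology (k : Type) [CommRing k] (q : ℕ) : TopCat.{u} ⥤ ModuleCat.{u} k :=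
  (AlgebraicTopology.singularHomologyFunctor (ModuleCat.{u} k) q).obj
    (ModuleCat.of k (ULift.{u} k))

/-- The `q`-th persistent homology `H_q(𝕏; k)`: the modules `H_q(X_t; k)` and the maps induced by
the inclusions. -/
def persistentHomology {T : Set ℝ} {Y : Type u} [TopologicalSpace Y] (X : FiniteFiltration T Y)
    (k : Type) [CommRing k] (q : ℕ) : T ⥤ ModuleCat.{u} k :=
  X.toFunctor ⋙ singularHomology k q

/-- The space `U_t` of the interval module `I(b, d)`: it is `k` if `b ≤ t < d`, and `0`
otherwise. -/
def intervalSpace (k : Type) [Field k] (b : ℝ) (d : EReal) (t : ℝ) : Submodule k k where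
  carrier := {x | ¬ (b ≤ t ∧ (t : EReal) < d) → x = 0}
  zero_mem' _ := rfl
  add_mem' hx hy h := by rw [hx h, hy h, add_zero]
  smul_mem' c x hx h := by rw [hx h, smul_zero]

open scoped Classical in
/-- The transition map `U_s → U_t` of the interval module `I(b, d)`: the identity if
`b ≤ s ≤ t < d`, and `0` otherwise. -/
def intervalMap (k : Type) [Field k] (b : ℝ) (d : EReal) {s t : ℝ} (hst : s ≤ t) :
    intervalSpace k b d s →ₗ[k] intervalSpace k b d t where
  toFun x := ⟨if b ≤ s ∧ (t : EReal) < d then (x : k) else 0, by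
    intro h
    rw [if_neg]
    exact fun h' => h ⟨h'.1.trans hst, h'.2⟩⟩
  map_add' x y := by
    ext
    by_cases h : b ≤ s ∧ (t : EReal) < d <;> simp [h]
  map_smul' c x := by
    ext
    by_cases h : b ≤ s ∧ (t : EReal) < d <;> simp [h]

/-- `D` is the multiset of endpoints of an interval decomposition `V ≅ ⨁ i, I(b i, d i)` with
finitely many summands, where `b i ∈ T`, `d i ∈ T ∪ {∞}` and `b i < d i`. The isomorphism is
given by linear isomorphisms `e t` that commute with the transition maps. -/
def IsDiagramOf {T : Set ℝ} {k : Type} [Field k] (V : T ⥤ ModuleCat.{u} k)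
    (D : Multiset (ℝ × EReal)) : Prop :=
  ∃ (L : ℕ) (b : Fin L → ℝ) (d : Fin L → EReal),
    (∀ i, b i ∈ T ∧ (d i = ⊤ ∨ ∃ x ∈ T, d i = (x : EReal)) ∧ (b i : EReal) < d i) ∧
    D = (Finset.univ : Finset (Fin L)).val.map (fun i => (b i, d i)) ∧
    ∃ e : ∀ t : T, V.obj t ≃ₗ[k] (∀ i : Fin L, intervalSpace k (b i) (d i) t),
      ∀ (s t : T) (hst : s ≤ t) (v : V.obj s) (i : Fin L),
        e t (V.map (homOfLE hst) v) i = intervalMap k (b i) (d i) hst (e s v i)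

open scoped Classical in
/-- The multiset of birth-death pairs of a persistence module `V` that has an interval
decomposition with finitely many summands (the empty multiset for any other `V`). -/
def diagramOf {T : Set ℝ} {k : Type} [Field k] (V : T ⥤ ModuleCat.{u} k) :
    Multiset (ℝ × EReal) :=
  if h : ∃ D, IsDiagramOf V D then h.choose else 0

/-- The `q`-th persistence diagram `D_q(𝕏; k)`. -/
def persistenceDiagram {T : Set ℝ} {Y : Type u} [TopologicalSpace Y] (X : FiniteFiltration T Y)
    (k : Type) [Field k] (q : ℕ) : Multiset (ℝ × EReal) :=
  diagramOf (persistentHomology X k q)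

/-- The sum of `f (d - b)` over the pairs `(b, d)` of a diagram (all of whose death times are
meant to be finite). -/
def lifetimeSum (f : ℝ → ℝ) (D : Multiset (ℝ × EReal)) : ℝ :=
  (D.map fun z => f (z.2.toReal - z.1)).sum

open scoped Classical in
/-- The `ℓ^∞`-distance of two points `(b, d)` and `(b', d')`, where `|∞ - ∞| = 0`. -/
def pairDist (x y : ℝ × EReal) : ℝ≥0∞ :=
  max (ENNReal.ofReal |x.1 - y.1|) (if x.2 = y.2 then 0 else (x.2 - y.2).abs)

/-- `γ` is a matching of the diagrams `D` and `D'`, that is, a bijection from `D` together with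
finitely many points of the diagonal to `D'` together with finitely many points of the diagonal;
all other points of the diagonal are matched to themselves, at no cost. -/
def IsMatching (D D' : Multiset (ℝ × EReal)) (γ : Multiset ((ℝ × EReal) × (ℝ × EReal))) : Prop :=
  ∃ A B : Multiset ℝ,
    γ.map Prod.fst = D + A.map (fun a : ℝ => ((a, (a : EReal)) : ℝ × EReal)) ∧
    γ.map Prod.snd = D' + B.map (fun a : ℝ => ((a, (a : EReal)) : ℝ × EReal))

/-- The `r`-Wasserstein distance of two diagrams. -/
def wassersteinDist (r : ℝ) (D D' : Multiset (ℝ × EReal)) : ℝ≥0∞ :=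
  ⨅ (γ : Multiset ((ℝ × EReal) × (ℝ × EReal))) (_ : IsMatching D D' γ),
    ((γ.map fun z => pairDist z.1 z.2 ^ r).sum) ^ (1 / r)

end PersistentHomology

end

namespace PersistentHomology

universe u

open Limits TensorProduct

/-! Since `H_{q-1}(X_t; ℤ)` is free, the Tor term in the universal coefficient theorem vanishes, and
`H_q(X_t; k) ≅ k ⊗ H_q(X_t; ℤ)` naturally in `t` (`preservesLeftHomologyOf_singularChains`,
`singularHomologyBaseChange_naturality`). So all persistence maps over `ℝ` and over `ZMod p` are
base changes of the same integral maps between free modules. Base change to `ℝ` keeps the rank of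
such a map, and reduction modulo `p` can only lower it.

The rank of the map from time `s` to time `t` is the number of diagram points with `b ≤ s` and `t <
d` (`IsDiagramOf.finrank_range`). Hence these counts are at most as large over `ZMod p` as over `ℝ`.
For `s = t` they agree, both being the rank of `H_q(X_t; ℤ)`.

Summation by parts on a common grid of birth and death times writes `∑ f(d - b)` as a combination of
these counts (`sum_eq_sum_secondDifference`). The coefficients are mixed second differences of `f(d
- b)`: nonnegative off the diagonal for convex `f`, positive for strictly convex `f`. On the
diagonal their sign is arbitrary, but there the counts agree. This gives the inequality; in the
strict case equality makes all counts agree, and the counts determine the diagram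
(`eq_of_aliveCount_eq`). The distance to the empty diagram is `(∑ ((d - b)/2)^r)^(1/r)`, so the
Wasserstein inequality is the case `f(x) = (x/2)^r`.

The existence of diagrams comes from an interval decomposition theorem proved by choosing
complements (`exists_classes`, `exists_generators`). It needs finitely generated homology; without
it neither field admits a finite diagram, both diagrams are empty by convention, and all claims are
trivial. -/

/-! ### Extension of scalars of singular chains -/

/-- Extension of scalars along `R → k`. -/
noncomputable abbrev baseChange (R k : Type) [CommRing R] [CommRing k] [Algebra R k]
    : ModuleCat.{u} R ⥤ ModuleCat.{u} k :=
  ModuleCat.extendScalars.{0, 0, u} (algebraMap R k)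

/-- Extension of scalars is left adjoint to restriction of scalars. -/
noncomputable abbrev baseChangeAdj (R k : Type) [CommRing R] [CommRing k] [Algebra R k] :
    baseChange.{u} R k ⊣ ModuleCat.restrictScalars.{u, 0, 0} (algebraMap R k) :=
  ModuleCat.extendRestrictScalarsAdj.{u, 0, 0} (algebraMap R k)

instance (R k : Type) [CommRing R] [CommRing k] [Algebra R k] : (baseChange.{u} R k).Additive :=
  (baseChangeAdj.{u} R k).left_adjoint_additive

instance (R k : Type) [CommRing R] [CommRing k] [Algebra R k]
    : PreservesColimitsOfSize.{u, u} (baseChange.{u} R k) :=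
  (baseChangeAdj.{u} R k).leftAdjoint_preservesColimits

instance (R k : Type) [CommRing R] [CommRing k] [Algebra R k]
    : PreservesColimitsOfSize.{0, 0} (baseChange.{u} R k) :=
  (baseChangeAdj.{u} R k).leftAdjoint_preservesColimits

open ChangeOfRings in
theorem baseChange_induction {R k : Type} [CommRing R] [CommRing k] [Algebra R k]
    {M : ModuleCat.{u} R}
    {P : (baseChange R k).obj M → Prop} (zero : P 0)
    (tmul : ∀ (a : k) (m : M), P (a ⊗ₜ[R, algebraMap R k] m))
    (add : ∀ x y, P x → P y → P (x + y)) (x : (baseChange R k).obj M) : P x :=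
  TensorProduct.induction_on (motive := P) x zero tmul add

/-- The values of `baseChange R k` as tensor products over `R`. -/
noncomputable def baseChangeEquiv (R k : Type) [CommRing R] [CommRing k] [Algebra R k]
    (M : ModuleCat.{u} R) :
    (baseChange R k).obj M ≃ₗ[k] k ⊗[R] M :=
  -- The `R`-action on `k` by restriction of scalars and the one of the algebra structure agree by
  -- `Algebra.smul_def`.
  let e : (ModuleCat.restrictScalars (algebraMap R k)).obj (ModuleCat.of k k) ≃ₗ[R] k :=
    { AddEquiv.refl k with map_smul' := fun (c : R) (x : k) => (Algebra.smul_def c x).symm }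
  let E' := TensorProduct.congr e (LinearEquiv.refl R M)
  let E : (baseChange R k).obj M ≃+ k ⊗[R] M :=
    { E' with }
  { E with
    map_smul' := fun c x => by
      change E (c • x) = c • E x
      induction x using baseChange_induction with
      | zero => rw [smul_zero, map_zero, smul_zero]
      | tmul a m => rfl
      | add x y hx hy => rw [smul_add, map_add, map_add, smul_add, hx, hy] }

theorem baseChangeEquiv_map (R k : Type) [CommRing R] [CommRing k] [Algebra R k]
    {M N : ModuleCat.{u} R} (f : M ⟶ N)
    (x : (baseChange R k).obj M) : baseChangeEquiv R k N ((baseChange R k).map f x) =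
      f.hom.baseChange k (baseChangeEquiv R k M x) := by
  induction x using baseChange_induction with
  | zero => simp only [map_zero]
  | tmul a m => rfl
  | add x y hx hy => simp only [map_add, hx, hy]

/-- Extension of scalars takes the coefficient module `R` to the coefficient module `k`. -/
noncomputable def baseChangeULift (R k : Type) [CommRing R] [CommRing k] [Algebra R k] :
    (baseChange.{u} R k).obj (ModuleCat.of R (ULift.{u} R)) ≅ ModuleCat.of k (ULift.{u} k) :=
  (baseChangeEquiv R k _ ≪≫ₗ TensorProduct.AlgebraTensorModule.congr (LinearEquiv.refl k k)
    ULift.moduleEquiv ≪≫ₗ TensorProduct.AlgebraTensorModule.rid R k k ≪≫ₗ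
    ULift.moduleEquiv.symm).toModuleIso

theorem map_ι_preservesCoproductIso_hom {C D : Type*} [Category* C] [Category* D] (G : C ⥤ D)
    {J : Type*} (f : J → C) [HasCoproduct f] [HasCoproduct fun j => G.obj (f j)]
    [PreservesColimit (Discrete.functor f) G] (j : J) :
    G.map (Sigma.ι f j) ≫ (PreservesCoproduct.iso G f).hom = Sigma.ι (fun j => G.obj (f j)) j := by
  rw [← Iso.eq_comp_inv, PreservesCoproduct.inv_hom, ι_comp_sigmaComparison]

/-- Extension of scalars commutes with the formation of coproducts of copies of the coefficients. -/
noncomputable def sigmaConstBaseChange (R k : Type) [CommRing R] [CommRing k] [Algebra R k] :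
    sigmaConst.obj (ModuleCat.of R (ULift.{u} R)) ⋙ baseChange.{u} R k ≅
      sigmaConst.obj (ModuleCat.of k (ULift.{u} k)) :=
  NatIso.ofComponents (fun J => PreservesCoproduct.iso (baseChange R k) _ ≪≫
    Sigma.mapIso fun _ => baseChangeULift R k) (fun {I J} f => by
      rw [← cancel_epi (PreservesCoproduct.iso (baseChange.{u} R k)
        (fun _ : I => ModuleCat.of R (ULift.{u} R))).inv]
      refine Sigma.hom_ext _ _ fun i => ?_
      simp only [PreservesCoproduct.inv_hom, ι_comp_sigmaComparison_assoc, Iso.trans_hom,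
        Functor.comp_map, sigmaConst_obj_map, Category.assoc, ← Functor.map_comp_assoc,
        Sigma.ι_comp_map', Category.id_comp]
      have h (J : Type u) (j : J) := map_ι_preservesCoproductIso_hom (baseChange.{u} R k)
        (fun _ : J => ModuleCat.of R (ULift.{u} R)) j
      erw [reassoc_of% h J (f i), reassoc_of% h I i]
      simp)

/-- Extension of scalars of the singular chain complex. -/
noncomputable def singularChainsBaseChange (R k : Type) [CommRing R] [CommRing k] [Algebra R k] :
    ((AlgebraicTopology.singularChainComplexFunctor (ModuleCat.{u} R)).obj
        (ModuleCat.of R (ULift.{u} R))) ⋙ (baseChange.{u} R k).mapHomologicalComplex _ ≅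
      (AlgebraicTopology.singularChainComplexFunctor (ModuleCat.{u} k)).obj
        (ModuleCat.of k (ULift.{u} k)) :=
  -- An additive functor commutes with alternating sums of face maps, so only the coproducts of
  -- coefficients in each degree remain to be compared.
  Functor.isoWhiskerLeft (TopCat.toSSet ⋙ (SimplicialObject.whiskering _ _).obj
      (sigmaConst.obj (ModuleCat.of R (ULift.{u} R))))
      (eqToIso (AlgebraicTopology.map_alternatingFaceMapComplex (baseChange.{u} R k))) ≪≫
    Functor.isoWhiskerLeft TopCat.toSSet (Functor.isoWhiskerRight
      ((SimplicialObject.whiskering _ _).mapIso (sigmaConstBaseChange R k))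
      (AlgebraicTopology.alternatingFaceMapComplex _))

/-! ### Kernels and homology under base change over a Dedekind domain -/

section BaseChangeKernel

variable {R K M N : Type*} [CommRing R] [IsDedekindDomain R] [AddCommGroup K]
  [AddCommGroup M] [AddCommGroup N] [Module R K] [Module R M] [Module R N]
  (i : K →ₗ[R] M) (f : M →ₗ[R] N) (k : Type*) [CommRing k] [Algebra R k]

omit [IsDedekindDomain R] in
theorem exact_rangeRestrict (hif : Function.Exact i f) : Function.Exact i f.rangeRestrict := by
  rwa [LinearMap.exact_iff, LinearMap.ker_rangeRestrict, ← LinearMap.exact_iff]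

/-- The range of `f` lies in `N`, so it is torsion-free and hence flat over a Dedekind domain. A
short exact sequence with flat quotient stays exact on the left after tensoring with any `k`. -/
theorem baseChange_injective_of_exact [Module.IsTorsionFree R N] (hi : Function.Injective i)
    (hif : Function.Exact i f) : Function.Injective (i.baseChange k) :=
  LinearMap.lTensor_injective_of_exact_of_flat f.rangeRestrict f.surjective_rangeRestrict i hi
    (exact_rangeRestrict i f hif) k

theorem baseChange_range_subtype_injective [Module.IsTorsionFree R (N ⧸ LinearMap.range f)] :
    Function.Injective ((LinearMap.range f).subtype.baseChange k) :=
  LinearMap.lTensor_injective_of_exact_of_flat (LinearMap.range f).mkQ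
    (Submodule.mkQ_surjective _) _ (Submodule.subtype_injective _)
    (LinearMap.exact_subtype_mkQ _) k

/-- Right exactness gives exactness with the range of `f` as target; passing from the range to `N`
is harmless because its inclusion stays injective when the cokernel is torsion-free. -/
theorem baseChange_exact_of_exact [Module.IsTorsionFree R (N ⧸ LinearMap.range f)]
    (hif : Function.Exact i f) : Function.Exact (i.baseChange k) (f.baseChange k) := by
  have h : Function.Exact (i.baseChange k) (f.rangeRestrict.baseChange k) :=
    lTensor_exact k (exact_rangeRestrict i f hif) f.surjective_rangeRestrict
  have hf : f.baseChange k =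
      (LinearMap.range f).subtype.baseChange k ∘ₗ f.rangeRestrict.baseChange k := by
    rw [← LinearMap.baseChange_comp]
    rfl
  intro x
  rw [← h x, hf, LinearMap.comp_apply,
    map_eq_zero_iff _ (baseChange_range_subtype_injective f k)]

end BaseChangeKernel

/-- This replaces flatness of `k`, which fails for `ZMod p` over `ℤ`: torsion-free target and
cokernel of `f` suffice for its kernel to survive base change. -/
theorem preservesLimit_baseChange (R k : Type) [CommRing R] [IsDedekindDomain R]
    [CommRing k] [Algebra R k]
    {M N : ModuleCat.{u} R} (f : M ⟶ N)
    [Module.IsTorsionFree R N] [Module.IsTorsionFree R (N ⧸ LinearMap.range f.hom)] :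
    PreservesLimit (parallelPair f 0) (baseChange R k) := by
  refine preservesLimit_of_preserves_limit_cone (ModuleCat.kernelIsLimit f)
    ((KernelFork.isLimitMapConeEquiv _ _).symm ?_)
  let i := (ModuleCat.kernelCone f).ι
  have hi : Function.Injective i.hom := (LinearMap.ker f.hom).subtype_injective
  have hif : Function.Exact i.hom f.hom := LinearMap.exact_subtype_ker_map f.hom
  refine ModuleCat.isLimitKernelFork ((baseChange R k).map i) ((baseChange R k).map f) ?_ ?_
  · intro x
    have h := baseChange_exact_of_exact i.hom f.hom k hif (baseChangeEquiv R k M x)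
    rw [← baseChangeEquiv_map, LinearEquiv.map_eq_zero_iff] at h
    refine h.trans
      ⟨fun ⟨y, hy⟩ => ⟨(baseChangeEquiv R k _).symm y, (baseChangeEquiv R k M).injective ?_⟩,
      fun ⟨y, hy⟩ => ⟨baseChangeEquiv R k _ y, ?_⟩⟩
    · rw [← hy]
      exact (baseChangeEquiv_map R k i _).trans (by rw [LinearEquiv.apply_symm_apply])
    · rw [← hy]
      exact (baseChangeEquiv_map R k i _).symm
  · intro x y hxy
    apply (baseChangeEquiv R k _).injective
    apply baseChange_injective_of_exact i.hom f.hom k hi hif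
    exact (baseChangeEquiv_map R k i x).symm.trans
      ((congrArg (baseChangeEquiv R k M) hxy).trans (baseChangeEquiv_map R k i y))

theorem preservesLeftHomologyOf_baseChange (R k : Type) [CommRing R] [IsDedekindDomain R]
    [CommRing k] [Algebra R k]
    (S : ShortComplex (ModuleCat.{u} R)) [Module.IsTorsionFree R S.X₃]
    [Module.IsTorsionFree R (S.X₃ ⧸ LinearMap.range S.g.hom)] :
    (baseChange R k).PreservesLeftHomologyOf S where
  isPreservedBy _ :=
    { g := preservesLimit_baseChange R k S.g
      f' := inferInstance }

/-- If the homology of a complex `X₁ → X₂ → X₃` of modules without torsion has no torsion, then so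
has the cokernel of `X₁ → X₂`. -/
theorem isTorsionFree_cokernel {R : Type} [CommRing R] [IsDomain R]
    (S : ShortComplex (ModuleCat.{u} R)) [Module.IsTorsionFree R S.X₃]
    [Module.IsTorsionFree R S.homology] :
    Module.IsTorsionFree R (S.X₂ ⧸ LinearMap.range S.f.hom) := by
  have : Module.IsTorsionFree R (LinearMap.ker S.g.hom ⧸ LinearMap.range S.moduleCatToCycles) :=
    Function.Injective.moduleIsTorsionFree S.moduleCatHomologyIso.toLinearEquiv.symm
      (LinearEquiv.injective _) (fun r m => map_smul _ r m)
  refine .of_smul_eq_zero fun n x hx => ?_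
  obtain ⟨x, rfl⟩ := Submodule.mkQ_surjective _ x
  by_cases hn : n = 0
  · exact Or.inl hn
  refine Or.inr ?_
  rw [← map_smul, Submodule.mkQ_apply, Submodule.Quotient.mk_eq_zero] at hx
  obtain ⟨y, hy⟩ := hx
  -- If `n • x` is a boundary, then `n • g x = 0` in the torsion-free `X₃`, so `x` is a cycle. Its
  -- homology class is killed by `n`, hence zero.
  have hgx : S.g.hom x = 0 := by
    have : n • S.g.hom x = 0 := by
      rw [← map_smul, ← hy]
      exact S.moduleCat_zero_apply y
    exact (smul_eq_zero.1 this).resolve_left hn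
  have h0 : n • (LinearMap.range S.moduleCatToCycles).mkQ ⟨x, hgx⟩ = 0 := by
    rw [← map_smul, Submodule.mkQ_apply, Submodule.Quotient.mk_eq_zero]
    exact ⟨y, Subtype.ext hy⟩
  have h1 := (smul_eq_zero.1 h0).resolve_left hn
  rw [Submodule.mkQ_apply, Submodule.Quotient.mk_eq_zero] at h1 ⊢
  obtain ⟨z, hz⟩ := h1
  exact ⟨z, congrArg Subtype.val hz⟩

/-- The modules of singular chains have no torsion. -/
theorem isTorsionFree_sigma (R : Type) [CommRing R] [IsDomain R] (J : Type u) :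
    Module.IsTorsionFree R (∐ fun _ : J => ModuleCat.of R (ULift.{u} R) : ModuleCat.{u} R) := by
  classical
  let e := (ModuleCat.coprodIsoDirectSum (fun _ : J => ModuleCat.of R (ULift.{u} R))).toLinearEquiv
  have : Module.IsTorsionFree R (ULift.{u} R) :=
    Function.Injective.moduleIsTorsionFree (N := R) ULift.down ULift.down_injective fun _ _ => rfl
  refine .of_smul_eq_zero fun n x hx => ?_
  by_cases hn : n = 0
  · exact Or.inl hn
  refine Or.inr (e.injective ?_)
  rw [map_zero]
  have h := (map_smul e n x).symm.trans ((congrArg e hx).trans (map_zero e))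
  refine DFinsupp.ext fun j => ?_
  have h := DFunLike.congr_fun h j
  exact (smul_eq_zero.1 (show n • (e x j) = 0 from h)).resolve_left hn

/-- The singular chain complex of a space. -/
noncomputable abbrev singularChains (R : Type) [CommRing R] (A : TopCat.{u}) :
    ChainComplex (ModuleCat.{u} R) ℕ :=
  ((AlgebraicTopology.singularChainComplexFunctor (ModuleCat.{u} R)).obj
    (ModuleCat.of R (ULift.{u} R))).obj A

instance (R : Type) [CommRing R] [IsDomain R] (A : TopCat.{u}) (n : ℕ) :
    Module.IsTorsionFree R ((singularChains R A).X n) :=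
  isTorsionFree_sigma _ _

/-- Singular homology with free homology in the preceding degree commutes with extension of
scalars. -/
theorem preservesLeftHomologyOf_singularChains (R k : Type) [CommRing R] [IsDedekindDomain R]
    [CommRing k] [Algebra R k]
    (q : ℕ) (A : TopCat.{u})
    (h : ∀ m : ℕ, m + 1 = q → Module.Free R ((singularHomology R m).obj A)) :
    (baseChange R k).PreservesLeftHomologyOf ((singularChains R A).sc q) := by
  have h1 : Module.IsTorsionFree R ((singularChains R A).sc q).X₃ :=
    inferInstanceAs (Module.IsTorsionFree R ((singularChains R A).X _))
  have h2 : Module.IsTorsionFree R (((singularChains R A).sc q).X₃ ⧸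
      LinearMap.range ((singularChains R A).sc q).g.hom) := by
    change Module.IsTorsionFree R ((singularChains R A).X _ ⧸
      LinearMap.range ((singularChains R A).d q _).hom)
    -- In degree `0` the outgoing differential is zero and its cokernel is a module of chains; in
    -- degree `m + 1` the cokernel is torsion-free because `H_m` is.
    cases q with
    | zero =>
      rw [(singularChains R A).shape _ _ (by simp), ModuleCat.hom_zero, LinearMap.range_zero]
      exact Function.Injective.moduleIsTorsionFree (Submodule.quotEquivOfEqBot _ rfl)
        (LinearEquiv.injective _) (fun r m => map_smul _ r m)
    | succ m =>
      have := h m rfl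
      rw [ChainComplex.next_nat_succ]
      have hm : Module.IsTorsionFree R ((singularChains R A).sc m).homology :=
        inferInstanceAs (Module.IsTorsionFree R ((singularHomology R m).obj A))
      have hm' : Module.IsTorsionFree R ((singularChains R A).sc m).X₃ :=
        inferInstanceAs (Module.IsTorsionFree R ((singularChains R A).X _))
      have := isTorsionFree_cokernel ((singularChains R A).sc m)
      change Module.IsTorsionFree R ((singularChains R A).X m ⧸
        LinearMap.range ((singularChains R A).d _ m).hom) at this
      rwa [ChainComplex.prev] at this
  exact preservesLeftHomologyOf_baseChange R k _

/-- The homology of a space with coefficients in `k` by extension of scalars. -/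
noncomputable def singularHomologyBaseChange (R k : Type) [CommRing R] [CommRing k] [Algebra R k]
    (q : ℕ) (A : TopCat.{u})
    [(baseChange R k).PreservesLeftHomologyOf ((singularChains R A).sc q)] :
    (singularHomology k q).obj A ≅ (baseChange R k).obj ((singularHomology R q).obj A) :=
  (HomologicalComplex.homologyFunctor _ _ q).mapIso ((singularChainsBaseChange R k).app A).symm ≪≫
    ((singularChains R A).sc q).mapHomologyIso (baseChange R k)

theorem singularHomologyBaseChange_naturality (R k : Type) [CommRing R] [CommRing k] [Algebra R k]
    (q : ℕ) {A B : TopCat.{u}}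
    (f : A ⟶ B) [(baseChange R k).PreservesLeftHomologyOf ((singularChains R A).sc q)]
    [(baseChange R k).PreservesLeftHomologyOf ((singularChains R B).sc q)] :
    (singularHomology k q).map f ≫ (singularHomologyBaseChange R k q B).hom =
      (singularHomologyBaseChange R k q A).hom ≫
        (baseChange R k).map ((singularHomology R q).map f) := by
  have h1 := (singularChainsBaseChange.{u} R k).inv.naturality f
  have h2 := ShortComplex.mapHomologyIso_hom_naturality (F := baseChange R k)
    ((HomologicalComplex.shortComplexFunctor _ _ q).map
      (((AlgebraicTopology.singularChainComplexFunctor (ModuleCat.{u} R)).obj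
        (ModuleCat.of R (ULift.{u} R))).map f))
  have h3 := congrArg (HomologicalComplex.homologyFunctor _ _ q).map h1
  rw [Functor.map_comp, Functor.map_comp] at h3
  change _ ≫ (_ ≫ _) = (_ ≫ _) ≫ _
  rw [Category.assoc]
  refine (Category.assoc _ _ _).symm.trans ((congrArg (· ≫ _) h3).trans ?_)
  refine (Category.assoc _ _ _).trans (congrArg (_ ≫ ·) h2)

/-! ### Interval decomposition over a finite linear order -/

section Transition

variable {ι : Type*} [LinearOrder ι] {k : Type} [Field k] (V : ι ⥤ ModuleCat.{u} k)

/-- The transition map from `V i` to `V j`, equal to zero if `j < i`. -/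
noncomputable def transition (i j : ι) : V.obj i →ₗ[k] V.obj j :=
  if h : i ≤ j then (V.map (homOfLE h)).hom else 0

theorem transition_of_le {i j : ι} (h : i ≤ j) : transition V i j = (V.map (homOfLE h)).hom :=
  dif_pos h

@[simp]
theorem transition_self (i : ι) (v : V.obj i) : transition V i i v = v := by
  rw [transition_of_le V le_rfl]
  exact congrArg (fun f : V.obj i ⟶ V.obj i => f.hom v) (V.map_id i)

theorem transition_transition {i j l : ι} (hij : i ≤ j) (hjl : j ≤ l) (v : V.obj i) :
    transition V j l (transition V i j v) = transition V i l v := by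
  rw [transition_of_le V hij, transition_of_le V hjl, transition_of_le V (hij.trans hjl)]
  exact (congrArg (fun f : V.obj i ⟶ V.obj l => f.hom v)
    (V.map_comp (homOfLE hij) (homOfLE hjl))).symm

/-- The elements of `V b` that vanish at time `d`. -/
noncomputable def vanishing (b : ι) (d : WithTop ι) : Submodule k (V.obj b) :=
  d.recTopCoe ⊤ fun e => LinearMap.ker (transition V b e)

@[simp] theorem vanishing_top (b : ι) : vanishing V b ⊤ = ⊤ := rfl

@[simp] theorem vanishing_coe (b e : ι) : vanishing V b e = LinearMap.ker (transition V b e) := rfl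

/-- The elements of `V b` that vanish before time `d`. -/
noncomputable def vanishingBefore (b : ι) (d : WithTop ι) : Submodule k (V.obj b) :=
  ⨆ (e : ι) (_ : b ≤ e) (_ : (e : WithTop ι) < d), LinearMap.ker (transition V b e)

/-- The elements of `V b` that come from earlier times. -/
noncomputable def bornBefore (b : ι) : Submodule k (V.obj b) :=
  ⨆ (c : ι) (_ : c < b), LinearMap.range (transition V c b)

theorem ker_le_vanishingBefore {b e : ι} {d : WithTop ι} (h : b ≤ e) (h' : (e : WithTop ι) < d) :
    LinearMap.ker (transition V b e) ≤ vanishingBefore V b d :=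
  le_iSup_of_le e (le_iSup_of_le h (le_iSup_of_le h' le_rfl))

theorem transition_mem_bornBefore {c b : ι} (h : c < b) (v : V.obj c) :
    transition V c b v ∈ bornBefore V b :=
  Submodule.mem_iSup_of_mem c (Submodule.mem_iSup_of_mem h ⟨v, rfl⟩)

theorem vanishingBefore_le (b : ι) (d : WithTop ι) : vanishingBefore V b d ≤ vanishing V b d := by
  refine iSup_le fun e => iSup_le fun hbe => iSup_le fun hed => ?_
  induction d using WithTop.recTopCoe with
  | top => exact le_top
  | coe d =>
    intro v hv
    rw [vanishing_coe, LinearMap.mem_ker,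
      ← transition_transition V hbe (WithTop.coe_lt_coe.1 hed).le, LinearMap.mem_ker.1 hv, map_zero]

/-- There are spaces `W b d` of classes that are born at time `b` and die at time `d`. -/
theorem exists_classes : ∃ W : ∀ (b : ι) (_ : WithTop ι), Submodule k (V.obj b),
    (∀ b d, W b d ≤ vanishing V b d) ∧ (∀ (b : ι) (d : WithTop ι), ¬ b < d → W b d = ⊥) ∧
    (∀ b d, Disjoint (W b d) (vanishingBefore V b d ⊔ bornBefore V b ⊓ vanishing V b d)) ∧
    (∀ (b : ι) (d : WithTop ι), b < d →
      vanishing V b d ≤ W b d ⊔ (vanishingBefore V b d ⊔ bornBefore V b)) := by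
  have key : ∀ (b : ι) (d : WithTop ι), ∃ W : Submodule k (V.obj b), W ≤ vanishing V b d ∧
      (¬ b < d → W = ⊥) ∧
      Disjoint W (vanishingBefore V b d ⊔ bornBefore V b ⊓ vanishing V b d) ∧
      (b < d → vanishing V b d ≤ W ⊔ (vanishingBefore V b d ⊔ bornBefore V b)) := by
    intro b d
    by_cases hbd : (b : WithTop ι) < d
    swap
    · exact ⟨⊥, bot_le, fun _ => rfl, disjoint_bot_left, fun h => absurd h hbd⟩
    -- Classes that die earlier or were born earlier are split off: a complement of their span, cut
    -- down to the classes that vanish at `d`, is taken.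
    obtain ⟨C, hC⟩ := exists_isCompl (vanishingBefore V b d ⊔ bornBefore V b ⊓ vanishing V b d)
    refine ⟨C ⊓ vanishing V b d, inf_le_right, fun h => absurd hbd h,
      hC.disjoint.symm.mono_left inf_le_left, fun _ v hv => ?_⟩
    have hv' : v ∈ (vanishingBefore V b d ⊔ bornBefore V b ⊓ vanishing V b d) ⊔ C := by
      rw [hC.sup_eq_top]
      trivial
    obtain ⟨y, hy, z, hz, rfl⟩ := Submodule.mem_sup.1 hv'
    have hyv : y ∈ vanishing V b d :=
      sup_le (vanishingBefore_le V b d) inf_le_right hy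
    have hzv : z ∈ vanishing V b d := by
      have := Submodule.sub_mem _ hv hyv
      rwa [add_sub_cancel_left] at this
    exact Submodule.add_mem _
      (Submodule.mem_sup_right ((sup_le le_sup_left (inf_le_left.trans le_sup_right) :
        vanishingBefore V b d ⊔ bornBefore V b ⊓ vanishing V b d ≤
          vanishingBefore V b d ⊔ bornBefore V b) hy))
      (Submodule.mem_sup_left ⟨hz, hzv⟩)
  choose W h1 h2 h3 h4 using key
  exact ⟨W, h1, h2, h3, h4⟩

section Finite

variable [Finite ι] {W : ∀ (b : ι) (_ : WithTop ι), Submodule k (V.obj b)}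

/-- Induction on the death time `d`: what vanishes before `d` is covered by the classes with earlier
death. -/
theorem vanishing_le_of_classes
    (hW : ∀ (b : ι) (d : WithTop ι), b < d →
      vanishing V b d ≤ W b d ⊔ (vanishingBefore V b d ⊔ bornBefore V b)) (b : ι) (d : WithTop ι)
    (hd : b < d) :
    vanishing V b d ≤ (⨆ (e : WithTop ι) (_ : b < e), W b e) ⊔ bornBefore V b := by
  induction d using WellFoundedLT.induction with
  | ind d ih =>
    refine (hW b d hd).trans (sup_le ?_ (sup_le ?_ le_sup_right))
    · exact le_sup_of_le_left (le_iSup_of_le d (le_iSup_of_le hd le_rfl))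
    · refine iSup_le fun e => iSup_le fun hbe => iSup_le fun hed => ?_
      rcases hbe.eq_or_lt with rfl | hbe
      · intro v hv
        rw [LinearMap.mem_ker, transition_self] at hv
        rw [hv]
        exact Submodule.zero_mem _
      · exact ih e hed (WithTop.coe_lt_coe.2 hbe)

/-- Induction on `t`. An element of `V t` is a sum of classes born at `t` and images of elements of
earlier spaces. The latter are generated by earlier classes, each of which is still alive at `t` or
has become zero. -/
theorem iSup_classes_eq_top (hle : ∀ b d, W b d ≤ vanishing V b d)
    (hW : ∀ (b : ι) (d : WithTop ι), b < d →
      vanishing V b d ≤ W b d ⊔ (vanishingBefore V b d ⊔ bornBefore V b)) (t : ι) :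
    ⨆ (b : ι) (_ : b ≤ t) (d : WithTop ι) (_ : t < d), (W b d).map (transition V b t) = ⊤ := by
  induction t using WellFoundedLT.induction with
  | ind t ih =>
    refine top_le_iff.1 ?_
    have h := vanishing_le_of_classes V hW t ⊤ (WithTop.coe_lt_top t)
    rw [vanishing_top] at h
    refine h.trans (sup_le ?_ ?_)
    · refine iSup_le fun e => iSup_le fun he => ?_
      refine le_iSup_of_le t (le_iSup_of_le le_rfl (le_iSup_of_le e (le_iSup_of_le he ?_)))
      exact fun v hv => ⟨v, hv, transition_self V t v⟩
    · refine iSup_le fun c => iSup_le fun hc => ?_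
      rw [LinearMap.range_eq_map, ← ih c hc, Submodule.map_iSup]
      refine iSup_le fun b => ?_
      rw [Submodule.map_iSup]
      refine iSup_le fun hbc => ?_
      rw [Submodule.map_iSup]
      refine iSup_le fun d => ?_
      rw [Submodule.map_iSup]
      refine iSup_le fun hcd => ?_
      by_cases htd : (t : WithTop ι) < d
      · refine le_iSup_of_le b (le_iSup_of_le (hbc.trans hc.le)
          (le_iSup_of_le d (le_iSup_of_le htd ?_)))
        rintro _ ⟨_, ⟨v, hv, rfl⟩, rfl⟩
        exact ⟨v, hv, (transition_transition V hbc hc.le v).symm⟩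
      · rintro _ ⟨_, ⟨v, hv, rfl⟩, rfl⟩
        induction d using WithTop.recTopCoe with
        | top => exact absurd (WithTop.coe_lt_top t) htd
        | coe d =>
          have hcd := WithTop.coe_lt_coe.1 hcd
          have hdt := not_lt.1 fun h => htd (WithTop.coe_lt_coe.2 h)
          have hv0 : transition V b d v = 0 := hle b d hv
          rw [transition_transition V hbc hc.le,
            ← transition_transition V (hbc.trans hcd.le) hdt, hv0, map_zero]
          exact Submodule.zero_mem _

end Finite

/-- Independence of living classes. In a nontrivial relation, take the latest birth `b'` and, for
it, the latest death `d'`. The other terms come from `x`, born before `b'`, and `y`, vanishing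
before `d'`. Since `w b' d' + y + x` is already zero at `t < d'`, the term `w b' d'` lies in the
space from which `W b' d'` is disjoint. -/
theorem eq_zero_of_sum_classes [Fintype ι] {W : ∀ (b : ι) (_ : WithTop ι), Submodule k (V.obj b)}
    (hle : ∀ b d, W b d ≤ vanishing V b d)
    (hW : ∀ b d, Disjoint (W b d) (vanishingBefore V b d ⊔ bornBefore V b ⊓ vanishing V b d))
    (t : ι) (w : ∀ (b : ι) (_ : WithTop ι), V.obj b) (hw : ∀ b d, w b d ∈ W b d)
    (hw0 : ∀ (b : ι) (d : WithTop ι), ¬ (b ≤ t ∧ t < d) → w b d = 0)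
    (hsum : ∑ b, ∑ d, transition V b t (w b d) = 0) (b : ι) (d : WithTop ι) : w b d = 0 := by
  classical
  by_contra hne
  let B := Finset.univ.filter fun b => ∃ d, w b d ≠ 0
  have hB : B.Nonempty := ⟨b, by simpa [B] using ⟨d, hne⟩⟩
  obtain ⟨b', hb', hbmax⟩ := B.exists_max_image id hB
  let E := Finset.univ.filter fun d => w b' d ≠ 0
  have hE : E.Nonempty := by
    obtain ⟨e, he⟩ := (Finset.mem_filter.1 hb').2
    exact ⟨e, by simpa [E] using he⟩
  obtain ⟨d', hd', hdmax⟩ := E.exists_max_image id hE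
  have hne' : w b' d' ≠ 0 := (Finset.mem_filter.1 hd').2
  have hact : b' ≤ t ∧ t < d' := by
    by_contra h
    exact hne' (hw0 b' d' h)
  have hx : ∃ x ∈ bornBefore V b',
      ∑ b ∈ Finset.univ.erase b', ∑ d, transition V b t (w b d) = transition V b' t x := by
    have : ∑ b ∈ Finset.univ.erase b', ∑ d, transition V b t (w b d) ∈
        (bornBefore V b').map (transition V b' t) := by
      refine Submodule.sum_mem _ fun b hb => Submodule.sum_mem _ fun d _ => ?_
      by_cases h0 : w b d = 0
      · rw [h0, map_zero]
        exact Submodule.zero_mem _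
      have hbb : b < b' := lt_of_le_of_ne
        (hbmax b (Finset.mem_filter.2 ⟨Finset.mem_univ _, d, h0⟩)) (Finset.ne_of_mem_erase hb)
      exact ⟨_, transition_mem_bornBefore V hbb (w b d),
        transition_transition V hbb.le hact.1 _⟩
    obtain ⟨x, hx, hx'⟩ := this
    exact ⟨x, hx, hx'.symm⟩
  obtain ⟨x, hx, hx'⟩ := hx
  have hy : ∑ d ∈ Finset.univ.erase d', w b' d ∈ vanishingBefore V b' d' := by
    refine Submodule.sum_mem _ fun d hd => ?_
    by_cases h0 : w b' d = 0
    · rw [h0]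
      exact Submodule.zero_mem _
    have hdd : d < d' := lt_of_le_of_ne
      (hdmax d (Finset.mem_filter.2 ⟨Finset.mem_univ _, h0⟩)) (Finset.ne_of_mem_erase hd)
    have htd : t < d := by
      by_contra h
      exact h0 (hw0 b' d fun h' => h h'.2)
    have hmem := hle b' d (hw b' d)
    induction d using WithTop.recTopCoe with
    | top => exact absurd le_top (not_le.2 hdd)
    | coe d => exact ker_le_vanishingBefore V (hact.1.trans (WithTop.coe_lt_coe.1 htd).le) hdd hmem
  set y := ∑ d ∈ Finset.univ.erase d', w b' d with hydef
  have hz : w b' d' + y + x ∈ vanishingBefore V b' d' := by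
    refine ker_le_vanishingBefore V hact.1 hact.2 (LinearMap.mem_ker.2 ?_)
    rw [map_add, ← hx', hydef, Finset.add_sum_erase _ _ (Finset.mem_univ _), map_sum,
      Finset.add_sum_erase _ (fun b => ∑ d, transition V b t (w b d)) (Finset.mem_univ _), hsum]
  have hwy := Submodule.add_mem _ (hle b' d' (hw b' d')) (vanishingBefore_le V b' d' hy)
  have hxv : x ∈ vanishing V b' d' := by
    have := Submodule.sub_mem _ (vanishingBefore_le V b' d' hz) hwy
    rwa [add_sub_cancel_left] at this
  refine hne' ((Submodule.disjoint_def.1 (hW b' d')) _ (hw b' d') ?_)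
  have : w b' d' = (w b' d' + y + x - y) - x := by abel
  rw [this]
  exact Submodule.sub_mem _ (Submodule.mem_sup_left (Submodule.sub_mem _ hz hy))
    (Submodule.mem_sup_right ⟨hx, hxv⟩)

end Transition

/-- A functor from a finite linear order to finite-dimensional vector spaces has a finite family of
generators `v j`, each living from time `b j` until before `d j`, such that those alive at time `t`
give a basis at time `t`. -/
theorem exists_generators {ι : Type} [LinearOrder ι] [Fintype ι] {k : Type} [Field k]
    (V : ι ⥤ ModuleCat.{u} k) [∀ t, Module.Finite k (V.obj t)] :
    ∃ (J : Type) (_ : Fintype J) (b : J → ι) (d : J → WithTop ι) (v : ∀ j, V.obj (b j)),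
      (∀ j, b j < d j) ∧ (∀ (j : J) (e : ι), d j = e → transition V (b j) e (v j) = 0) ∧
      ∀ (t : ι) (y : V.obj t), ∃! x : J → k, (∀ j, ¬ (b j ≤ t ∧ t < d j) → x j = 0) ∧
        ∑ j, x j • transition V (b j) t (v j) = y := by
  classical
  obtain ⟨W, hle, hbot, hdis, hspan⟩ := exists_classes V
  have hfin : ∀ b d, Module.Finite k (W b d) := fun b d => inferInstance
  let B := fun p : ι × WithTop ι => Module.finBasis k (W p.1 p.2)
  have hlt : ∀ j : (Σ p : ι × WithTop ι, Fin (Module.finrank k (W p.1 p.2))),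
      j.1.1 < j.1.2 := by
    rintro ⟨p, i⟩
    by_contra h
    have h0 : Module.finrank k (W p.1 p.2) = 0 := by rw [hbot _ _ h, finrank_bot]
    exact (h0 ▸ i).elim0
  refine ⟨Σ p : ι × WithTop ι, Fin (Module.finrank k (W p.1 p.2)), inferInstance,
    fun j => j.1.1, fun j => j.1.2, fun j => (B j.1 j.2 : V.obj j.1.1), hlt, ?_, ?_⟩
  · rintro ⟨⟨b, d⟩, i⟩ e (rfl : d = e)
    exact hle b e (B (b, _) i).2
  intro t y
  refine existsUnique_of_exists_of_unique ?_ ?_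
  · let u : (Σ p : ι × WithTop ι, Fin (Module.finrank k (W p.1 p.2))) → V.obj t := fun j =>
      if j.1.1 ≤ t ∧ t < j.1.2 then transition V j.1.1 t (B j.1 j.2) else 0
    have hy : y ∈ LinearMap.range (Fintype.linearCombination k u) := by
      have : (⊤ : Submodule k (V.obj t)) ≤ LinearMap.range (Fintype.linearCombination k u) := by
        rw [← iSup_classes_eq_top V hle hspan t]
        refine iSup_le fun b => iSup_le fun hbt => iSup_le fun d => iSup_le fun htd => ?_
        rintro _ ⟨z, hz, rfl⟩
        rw [Fintype.range_linearCombination]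
        have hz' := (B (b, d)).sum_repr ⟨z, hz⟩
        have hz'' := congrArg Subtype.val hz'
        rw [Submodule.coe_sum] at hz''
        change _ = z at hz''
        rw [← hz'', map_sum]
        refine Submodule.sum_mem _ fun i _ => ?_
        rw [Submodule.coe_smul, map_smul]
        refine Submodule.smul_mem _ _ (Submodule.subset_span ⟨⟨(b, d), i⟩, ?_⟩)
        exact if_pos ⟨hbt, htd⟩
      exact this trivial
    obtain ⟨x, rfl⟩ := hy
    refine ⟨fun j => if j.1.1 ≤ t ∧ t < j.1.2 then x j else 0, fun j hj => if_neg hj, ?_⟩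
    rw [Fintype.linearCombination_apply]
    refine Finset.sum_congr rfl fun j _ => ?_
    by_cases h : j.1.1 ≤ t ∧ t < j.1.2
    · simp only [u, if_pos h]
    · simp only [u, if_neg h, zero_smul, smul_zero]
  · rintro x x' ⟨hx, hxy⟩ ⟨hx', hxy'⟩
    rw [← sub_eq_zero]
    have hsum : ∑ j, (x - x') j • transition V j.1.1 t (B j.1 j.2 : V.obj j.1.1) = 0 := by
      simp only [Pi.sub_apply, sub_smul, Finset.sum_sub_distrib]
      rw [hxy, hxy', sub_self]
    have hz : ∀ j : (Σ p : ι × WithTop ι, Fin (Module.finrank k (W p.1 p.2))),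
        ¬ (j.1.1 ≤ t ∧ t < j.1.2) → (x - x') j = 0 := fun j hj => by
      rw [Pi.sub_apply, hx j hj, hx' j hj, sub_self]
    generalize x - x' = z at hsum hz
    -- The relation is grouped by birth-death pairs, to which `eq_zero_of_sum_classes` applies;
    -- within one pair the basis is independent.
    let w : ∀ p : ι × WithTop ι, W p.1 p.2 := fun p => ∑ i, z ⟨p, i⟩ • B p i
    have hw := eq_zero_of_sum_classes V hle hdis t (fun b d => (w (b, d) : V.obj b))
      (fun b d => (w (b, d)).2) (fun b d h => by
        have : w (b, d) = 0 := Finset.sum_eq_zero fun i _ => by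
          rw [hz ⟨(b, d), i⟩ h, zero_smul]
        rw [this]
        rfl) (by
        rw [← hsum, Fintype.sum_sigma, Fintype.sum_prod_type]
        refine Finset.sum_congr rfl fun b _ => Finset.sum_congr rfl fun d _ => ?_
        simp only [w, Submodule.coe_sum, Submodule.coe_smul, map_sum, map_smul])
    funext ⟨⟨b, d⟩, i⟩
    have hw' : w (b, d) = 0 := Subtype.ext (hw b d)
    exact Fintype.linearIndependent_iff.1 (B (b, d)).linearIndependent _ hw' i

/-! ### From generators to persistence diagrams -/

section IntervalMap

variable {k : Type} [Field k] {b : ℝ} {d : EReal} {s t : ℝ}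

theorem coe_intervalSpace_eq_zero (x : intervalSpace k b d t)
    (h : ¬ (b ≤ t ∧ (t : EReal) < d)) : (x : k) = 0 := x.2 h

open scoped Classical in
theorem coe_intervalMap (hst : s ≤ t) (x : intervalSpace k b d s) :
    (intervalMap k b d hst x : k) = if b ≤ s ∧ (t : EReal) < d then (x : k) else 0 := rfl

end IntervalMap

/-- A family of generators that gives bases at all times gives an interval decomposition. -/
theorem exists_isDiagramOf_of_generators {T : Set ℝ} {k : Type} [Field k]
    (V : T ⥤ ModuleCat.{u} k) {J : Type} [Fintype J] (b : J → T) (d : J → WithTop T)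
    (v : ∀ j, V.obj (b j)) (hbd : ∀ j, b j < d j)
    (hd : ∀ (j : J) (e : T), d j = e → transition V (b j) e (v j) = 0)
    (hv : ∀ (t : T) (y : V.obj t), ∃! x : J → k, (∀ j, ¬ (b j ≤ t ∧ t < d j) → x j = 0) ∧
        ∑ j, x j • transition V (b j) t (v j) = y) :
    ∃ D, IsDiagramOf V D := by
  classical
  let δ : WithTop T → EReal := fun e => e.recTopCoe ⊤ fun e => ((e : ℝ) : EReal)
  have hδ : ∀ (t : T) (e : WithTop T), ((t : ℝ) : EReal) < δ e ↔ t < e := by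
    intro t e
    induction e using WithTop.recTopCoe with
    | top => exact ⟨fun _ => WithTop.coe_lt_top t, fun _ => EReal.coe_lt_top _⟩
    | coe e => exact EReal.coe_lt_coe_iff.trans (Subtype.coe_lt_coe.trans WithTop.coe_lt_coe.symm)
  let σ := (Fintype.equivFin J).symm
  let I := fun (t : T) (i : Fin (Fintype.card J)) => intervalSpace k (b (σ i)) (δ (d (σ i))) t
  -- The decomposition is the inverse of the map that takes coordinates to combinations of
  -- generators; compatibility with transitions is checked for `Ψ`.
  let Ψ : ∀ t : T, (∀ i, I t i) →ₗ[k] V.obj t := fun t =>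
    ∑ i, (LinearMap.toSpanSingleton k _ (transition V (b (σ i)) t (v (σ i)))) ∘ₗ
      (I t i).subtype ∘ₗ LinearMap.proj i
  have hΨ : ∀ t x, Ψ t x = ∑ i, (x i : k) • transition V (b (σ i)) t (v (σ i)) := by
    intro t x
    simp [Ψ]
  have hact : ∀ (t : T) j, (b j ≤ t ∧ t < d j) ↔
      ((b j : ℝ) ≤ t ∧ ((t : ℝ) : EReal) < δ (d j)) := fun t j => by
    rw [hδ, Subtype.coe_le_coe]
  have hbij : ∀ t, Function.Bijective (Ψ t) := by
    intro t
    constructor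
    · intro x x' hxx
      obtain ⟨_, _, huniq⟩ := hv t (Ψ t x)
      have key : ∀ x'' : (∀ i, I t i), Ψ t x'' = Ψ t x →
          (∀ j, ¬ (b j ≤ t ∧ t < d j) → (x'' (σ.symm j) : k) = 0) ∧
        ∑ j, (x'' (σ.symm j) : k) • transition V (b j) t (v j) = Ψ t x := by
        intro x'' h
        refine ⟨fun j hj => ?_, ?_⟩
        · rw [hact] at hj
          refine coe_intervalSpace_eq_zero _ ?_
          rwa [Equiv.apply_symm_apply]
        · rw [← h, hΨ, ← Equiv.sum_comp σ]
          refine Finset.sum_congr rfl fun i _ => ?_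
          rw [Equiv.symm_apply_apply]
      have := (huniq _ (key x rfl)).trans (huniq _ (key x' hxx.symm)).symm
      funext i
      obtain ⟨j, rfl⟩ := σ.symm.surjective i
      exact Subtype.ext (congrFun this j)
    · intro y
      obtain ⟨x, ⟨hx, hxy⟩, _⟩ := hv t y
      refine ⟨fun i => ⟨x (σ i), fun h => hx _ ((hact _ _).not.2 h)⟩, ?_⟩
      rw [hΨ, ← hxy, ← Equiv.sum_comp σ]
  let e : ∀ t : T, V.obj t ≃ₗ[k] ∀ i, I t i := fun t =>
    (LinearEquiv.ofBijective (Ψ t) (hbij t)).symm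
  refine ⟨_, Fintype.card J, fun i => b (σ i), fun i => δ (d (σ i)), fun i => ⟨(b (σ i)).2, ?_, ?_⟩,
    rfl, e, ?_⟩
  · change δ (d (σ i)) = ⊤ ∨ ∃ x ∈ T, δ (d (σ i)) = (x : EReal)
    generalize d (σ i) = e
    induction e using WithTop.recTopCoe with
    | top => exact Or.inl rfl
    | coe e => exact Or.inr ⟨e, e.2, rfl⟩
  · exact (hδ _ _).2 (hbd _)
  · intro s t hst w i
    obtain ⟨x, rfl⟩ := (hbij s).2 w
    have hs : e s (Ψ s x) = x := (LinearEquiv.ofBijective (Ψ s) (hbij s)).symm_apply_apply x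
    rw [hs]
    have ht : V.map (homOfLE hst) (Ψ s x) = Ψ t fun i => intervalMap k _ _ hst (x i) := by
      change (V.map (homOfLE hst)).hom (Ψ s x) = _
      rw [← transition_of_le V hst, hΨ, hΨ, map_sum]
      refine Finset.sum_congr rfl fun i _ => ?_
      rw [map_smul, coe_intervalMap]
      by_cases hbs : b (σ i) ≤ s
      swap
      · rw [if_neg fun h => hbs h.1, coe_intervalSpace_eq_zero (x i) fun h => hbs h.1, zero_smul,
          zero_smul]
      rw [transition_transition V hbs hst]
      by_cases htd : ((t : ℝ) : EReal) < δ (d (σ i))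
      · rw [if_pos ⟨hbs, htd⟩]
      · rw [if_neg fun h => htd h.2, zero_smul]
        have h0 : transition V (b (σ i)) t (v (σ i)) = 0 := by
          rw [hδ] at htd
          obtain ⟨c, hc⟩ := WithTop.ne_top_iff_exists.1 fun h : d (σ i) = ⊤ => htd (by
            rw [h]
            exact WithTop.coe_lt_top t)
          have hbc : b (σ i) ≤ c := (WithTop.coe_lt_coe.1 (hc ▸ hbd (σ i))).le
          have hct : c ≤ t := not_lt.1 fun h => htd (hc ▸ WithTop.coe_lt_coe.2 h)
          rw [← transition_transition V hbc hct, hd _ c hc.symm, map_zero]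
        rw [h0, smul_zero]
    rw [ht]
    exact congrFun ((LinearEquiv.ofBijective (Ψ t) (hbij t)).symm_apply_apply _) i

/-- A pointwise finite-dimensional persistence module that changes only at finitely many times has
a persistence diagram. -/
theorem exists_isDiagramOf {T : Set ℝ} {k : Type} [Field k] (V : T ⥤ ModuleCat.{u} k)
    [∀ t, Module.Finite k (V.obj t)] (R : Finset T)
    (hR : ∀ t : T, ∃ c ∈ R, c ≤ t ∧ (∀ c' ∈ R, c' ≤ t → c' ≤ c) ∧
      Function.Bijective (transition V c t)) :
    ∃ D, IsDiagramOf V D := by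
  let ι := {t : T // t ∈ R}
  -- Decomposing the restriction to the finite set `R` suffices, since `V` is constant between
  -- consecutive times of `R`.
  let incl : ι ⥤ T := (Subtype.mono_coe (· ∈ R)).functor
  have htr : ∀ i j : ι, transition (incl ⋙ V) i j = transition V i.1 j.1 := by
    intro i j
    by_cases h : i ≤ j
    · rw [transition_of_le _ h, transition_of_le V (show i.1 ≤ j.1 from h)]
      rfl
    · have h' : ¬ i.1 ≤ j.1 := h
      rw [transition, transition, dif_neg h, dif_neg h']
      rfl
  have : ∀ i, Module.Finite k ((incl ⋙ V).obj i) := fun i =>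
    inferInstanceAs (Module.Finite k (V.obj i.1))
  obtain ⟨J, _, b, d, v, hbd, hd, hv⟩ := exists_generators (incl ⋙ V)
  -- `c` is the last time of `R` up to `t`, and births and deaths lie in `R`, so the same generators
  -- are alive at `c` and at `t`.
  have hact : ∀ (t : T) (c : ι), c.1 ≤ t → (∀ c' ∈ R, c' ≤ t → c' ≤ c.1) → ∀ j,
      ((b j ≤ c ∧ c < d j) ↔ ((b j).1 ≤ t ∧ t < (d j).map Subtype.val)) := by
    intro t c hct hmax j
    refine and_congr ⟨fun h => le_trans h hct, fun h => hmax _ (b j).2 h⟩ ?_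
    generalize d j = e
    induction e using WithTop.recTopCoe with
    | top => exact ⟨fun _ => WithTop.coe_lt_top t, fun _ => WithTop.coe_lt_top c⟩
    | coe e =>
      rw [WithTop.map_coe, WithTop.coe_lt_coe, WithTop.coe_lt_coe, ← not_le, ← not_le]
      exact not_congr ⟨fun h => le_trans h hct, fun h => hmax _ e.2 h⟩
  refine exists_isDiagramOf_of_generators V (fun j => (b j).1) (fun j => (d j).map Subtype.val) v
    ?_ ?_ ?_
  · intro j
    exact ((hact _ (b j) le_rfl (fun _ _ h => h) j).1 ⟨le_rfl, hbd j⟩).2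
  · intro j e he
    obtain ⟨e', he', rfl⟩ := (WithTop.map_eq_some_iff).1 he
    rw [← htr]
    exact hd j e' he'
  · intro t y
    obtain ⟨c, hc, hct, hmax, hbij⟩ := hR t
    obtain ⟨y, rfl⟩ := hbij.2 y
    have h : ∃! x : J → k, (∀ j, ¬ (b j ≤ ⟨c, hc⟩ ∧ (⟨c, hc⟩ : ι) < d j) → x j = 0) ∧
        ∑ j, x j • transition V (b j).1 c (v j) = y := by
      have h := hv ⟨c, hc⟩ y
      simp only [htr] at h
      exact h
    refine (existsUnique_congr fun x => ?_).1 h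
    refine and_congr (forall_congr' fun j => ?_) ?_
    · rw [hact t ⟨c, hc⟩ hct hmax]
    · have hj : ∀ j, transition V (b j).1 t (v j) =
          transition V c t (transition V (b j).1 c (v j)) := by
        intro j
        by_cases h : (b j).1 ≤ c
        · exact (transition_transition V h hct _).symm
        · have h' : ¬ (b j).1 ≤ t := fun h' => h (hmax _ (b j).2 h')
          rw [transition, transition, dif_neg h', transition, dif_neg h]
          exact (map_zero _).symm
      simp only [hj, ← map_smul, ← map_sum]
      exact hbij.1.eq_iff.symm

/-! ### Ranks of transition maps as counts of diagram points -/

section Rank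

variable {T : Set ℝ} {k : Type} [Field k] {V : T ⥤ ModuleCat.{u} k} {D : Multiset (ℝ × EReal)}

theorem IsDiagramOf.finite (h : IsDiagramOf V D) (t : T) : Module.Finite k (V.obj t) := by
  obtain ⟨L, b, d, -, -, e, -⟩ := h
  exact Module.Finite.equiv (e t).symm

theorem IsDiagramOf.mem (h : IsDiagramOf V D) {z : ℝ × EReal} (hz : z ∈ D) :
    z.1 ∈ T ∧ (z.2 = ⊤ ∨ ∃ x ∈ T, z.2 = (x : EReal)) ∧ (z.1 : EReal) < z.2 := by
  obtain ⟨L, b, d, hbd, rfl, -⟩ := h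
  obtain ⟨i, -, rfl⟩ := Multiset.mem_map.1 hz
  exact hbd i

open scoped Classical in
/-- The number of points of a diagram that are born by time `s` and alive at time `t`. -/
noncomputable def aliveCount (D : Multiset (ℝ × EReal)) (s t : ℝ) : ℕ :=
  D.countP fun z => z.1 ≤ s ∧ (t : EReal) < z.2

/-- The rank of a transition map of a persistence module, from a diagram. -/
theorem IsDiagramOf.finrank_range (h : IsDiagramOf V D) {s t : T} (hst : s ≤ t) :
    Module.finrank k (LinearMap.range (V.map (homOfLE hst)).hom) = aliveCount D s t := by
  classical
  obtain ⟨L, b, d, -, rfl, e, he⟩ := h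
  let P : Fin L → Prop := fun i => b i ≤ s ∧ ((t : ℝ) : EReal) < d i
  let g : (∀ i, intervalSpace k (b i) (d i) s) →ₗ[k] ∀ i, intervalSpace k (b i) (d i) t :=
    LinearMap.pi fun i => intervalMap k (b i) (d i) hst ∘ₗ LinearMap.proj i
  have hg : (e t).toLinearMap ∘ₗ (V.map (homOfLE hst)).hom = g ∘ₗ (e s).toLinearMap := by
    ext1 v
    funext i
    exact he s t hst v i
  have h1 : Module.finrank k (LinearMap.range (V.map (homOfLE hst)).hom) =
      Module.finrank k (LinearMap.range g) := by
    rw [← LinearEquiv.finrank_map_eq (e t), ← LinearMap.range_comp, hg,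
      LinearMap.range_comp, LinearEquiv.range, LinearMap.range_eq_map]
  -- The range of `g` consists of the vectors supported on the intervals containing both `s` and
  -- `t`; `φ` reads off these coordinates.
  let φ : (∀ i, intervalSpace k (b i) (d i) t) →ₗ[k] ({i // P i} → k) :=
    LinearMap.pi fun i => (intervalSpace k (b i) (d i) t).subtype ∘ₗ LinearMap.proj i.1
  have hgP : ∀ x i, ((g x i : intervalSpace k (b i) (d i) t) : k) =
      if P i then (x i : k) else 0 := fun x i => rfl
  have hφ : Function.Bijective (φ.domRestrict (LinearMap.range g)) := by
    constructor
    · rintro ⟨_, x, rfl⟩ ⟨_, x', rfl⟩ hxx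
      refine Subtype.ext (funext fun i => Subtype.ext ?_)
      by_cases hi : P i
      · exact congrFun hxx ⟨i, hi⟩
      · rw [hgP, hgP, if_neg hi, if_neg hi]
    · intro y
      have hP : ∀ i, P i → b i ≤ s ∧ ((s : ℝ) : EReal) < d i := fun i hi =>
        ⟨hi.1, lt_of_le_of_lt (EReal.coe_le_coe_iff.2 hst) hi.2⟩
      let x : ∀ i, intervalSpace k (b i) (d i) s := fun i =>
        ⟨if hi : P i then y ⟨i, hi⟩ else 0, fun h => dif_neg fun hi => h (hP i hi)⟩
      refine ⟨⟨g x, x, rfl⟩, funext fun i => ?_⟩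
      change ((g x i.1 : intervalSpace k _ _ t) : k) = _
      rw [hgP, if_pos i.2]
      exact dif_pos i.2
  rw [h1, (LinearEquiv.ofBijective _ hφ).finrank_eq, Module.finrank_fintype_fun_eq_card,
    aliveCount, Multiset.countP_map, Fintype.card_subtype]
  rfl

theorem IsDiagramOf.finrank_eq (h : IsDiagramOf V D) (t : T) :
    Module.finrank k (V.obj t) = aliveCount D t t := by
  rw [← h.finrank_range le_rfl]
  have : (V.map (homOfLE (le_refl t))).hom = LinearMap.id :=
    congrArg (fun f : V.obj t ⟶ V.obj t => f.hom) (V.map_id t)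
  rw [this, LinearMap.range_id, finrank_top]

end Rank

/-! ### Ranks of integral maps under base change -/

section BaseChangeRank

variable {R k M N : Type*} [CommRing R] [IsDomain R] [IsPrincipalIdealRing R] [Field k]
  [Algebra R k] [AddCommGroup M] [AddCommGroup N] [Module R M] [Module R N] [Module.Free R N]
  [Module.Finite R N] (f : M →ₗ[R] N)

-- Base change preserves surjectivity of `M → range f`, so the rank over `k` is governed by what
-- happens to the inclusion of `range f`, a free module over a principal ideal domain.
omit [IsDomain R] [IsPrincipalIdealRing R] [Module.Free R N] [Module.Finite R N] in
theorem range_baseChange :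
    LinearMap.range (f.baseChange k) =
      LinearMap.range ((LinearMap.range f).subtype.baseChange k) := by
  have hf : f.baseChange k =
      (LinearMap.range f).subtype.baseChange k ∘ₗ f.rangeRestrict.baseChange k := by
    rw [← LinearMap.baseChange_comp]
    rfl
  rw [hf, LinearMap.range_comp_of_range_eq_top]
  exact LinearMap.range_eq_top.2
    (LinearMap.lTensor_surjective k f.surjective_rangeRestrict)

variable (k) in
/-- The rank does not increase under extension of scalars to a field, for example under reduction
modulo a prime. -/
theorem finrank_range_baseChange_le :
    Module.finrank k (LinearMap.range (f.baseChange k)) ≤ Module.finrank R (LinearMap.range f) := by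
  rw [range_baseChange, ← Module.finrank_baseChange (R := k) (M' := LinearMap.range f)]
  exact LinearMap.finrank_range_le _

variable (k) in
/-- The rank does not change under flat extension of scalars. -/
theorem finrank_range_baseChange_of_flat [Module.Flat R k] :
    Module.finrank k (LinearMap.range (f.baseChange k)) = Module.finrank R (LinearMap.range f) := by
  rw [range_baseChange, ← Module.finrank_baseChange (R := k) (M' := LinearMap.range f)]
  exact LinearMap.finrank_range_of_inj
    (Module.Flat.lTensor_preserves_injective_linearMap _ (Submodule.subtype_injective _))

-- A free module keeps its rank under base change, so finiteness descends from `k` to `R`.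
omit [IsDomain R] [IsPrincipalIdealRing R] [Module.Finite R N] in
theorem finite_of_finite_baseChange [Nontrivial R] [Module.Finite k (k ⊗[R] N)] :
    Module.Finite R N := by
  rw [← Module.rank_lt_aleph0_iff, ← Cardinal.lift_lt_aleph0, ← Module.rank_baseChange (R := k),
    Module.rank_lt_aleph0_iff]
  infer_instance

end BaseChangeRank

/-! ### Summation by parts over a grid -/

section Telescoping

/-- The mixed second difference of a function of two times, which vanishes below the diagonal. -/
noncomputable def secondDifference (G : ℝ → ℝ → ℝ) (r : ℕ → ℝ) (i j : ℕ) : ℝ :=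
  let g : ℕ → ℕ → ℝ := fun i j => if i < j then G (r i) (r j) else 0
  (g i (j + 1) - g i j) - (g (i + 1) (j + 1) - g (i + 1) j)

theorem secondDifference_of_lt (G : ℝ → ℝ → ℝ) (r : ℕ → ℝ) {i j : ℕ} (h : j < i) :
    secondDifference G r i j = 0 := by
  have h1 : ¬ i < j + 1 := by omega
  have h2 : ¬ i < j := by omega
  have h4 : ¬ i + 1 < j := by omega
  simp [secondDifference, h1, h2, h4]

theorem sum_secondDifference (G : ℝ → ℝ → ℝ) (r : ℕ → ℝ) {a c : ℕ} (hac : a < c) :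
    ∑ i ∈ Finset.Ico a c, ∑ j ∈ Finset.Ico a c, secondDifference G r i j = G (r a) (r c) := by
  let g : ℕ → ℕ → ℝ := fun i j => if i < j then G (r i) (r j) else 0
  have h1 : ∀ i, ∑ j ∈ Finset.Ico a c, secondDifference G r i j =
      -((g (i + 1) c - g (i + 1) a) - (g i c - g i a)) := fun i => by
    change ∑ j ∈ Finset.Ico a c, ((g i (j + 1) - g i j) - (g (i + 1) (j + 1) - g (i + 1) j)) = _
    rw [Finset.sum_sub_distrib, Finset.sum_Ico_sub (g i) hac.le,
      Finset.sum_Ico_sub (g (i + 1)) hac.le]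
    ring
  rw [Finset.sum_congr rfl fun i _ => h1 i, Finset.sum_neg_distrib,
    Finset.sum_Ico_sub (fun i => g i c - g i a) hac.le]
  simp [g, hac, hac.le]

theorem aliveCount_cons (z : ℝ × EReal) (D : Multiset (ℝ × EReal)) (s t : ℝ)
    [Decidable (z.1 ≤ s ∧ (t : EReal) < z.2)] :
    aliveCount (z ::ₘ D) s t = aliveCount D s t + if z.1 ≤ s ∧ (t : EReal) < z.2 then 1 else 0 := by
  classical
  rw [aliveCount, aliveCount, Multiset.countP_cons]
  congr

/-- A sum over a diagram in terms of its numbers of living points. -/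
theorem sum_eq_sum_secondDifference (G : ℝ → ℝ → ℝ) {r : ℕ → ℝ} {n : ℕ}
    (hr : StrictMonoOn r (Iio n)) (D : Multiset (ℝ × EReal))
    (hD : ∀ z ∈ D, ∃ a c, a < c ∧ c < n ∧ z = (r a, (r c : EReal))) :
    (D.map fun z => G z.1 z.2.toReal).sum = ∑ i ∈ Finset.range n, ∑ j ∈ Finset.range n,
      secondDifference G r i j * aliveCount D (r i) (r j) := by
  classical
  induction D using Multiset.induction with
  | empty => simp [aliveCount]
  | cons z D ih =>
    rw [Multiset.map_cons, Multiset.sum_cons,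
      ih fun z hz => hD z (Multiset.mem_cons_of_mem hz)]
    obtain ⟨a, c, hac, hcn, rfl⟩ := hD z (Multiset.mem_cons_self z D)
    have hsub : Finset.Ico a c ⊆ Finset.range n := fun i hi =>
      Finset.mem_range.2 ((Finset.mem_Ico.1 hi).2.trans hcn)
    have key : G (r a) (r c) = ∑ i ∈ Finset.range n, ∑ j ∈ Finset.range n,
        secondDifference G r i j * if a ≤ i ∧ j < c then 1 else 0 := by
      -- The point `(r a, r c)` is counted for all `a ≤ i` and `j < c`, but below the diagonal the
      -- coefficient vanishes, which leaves the square `Ico a c × Ico a c` of the telescoping sum.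
      have hz : ∀ i j, a ≤ i → j < c → ¬ (i < c ∧ a ≤ j) → secondDifference G r i j = 0 := by
        intro i j hi hj h
        exact secondDifference_of_lt G r (by omega)
      rw [← sum_secondDifference G r hac]
      refine (Finset.sum_congr rfl fun i hi => ?_).trans (Finset.sum_subset hsub fun i _ hi => ?_)
      · rw [Finset.mem_Ico] at hi
        refine (Finset.sum_congr rfl fun j hj => ?_).trans (Finset.sum_subset hsub fun j _ hj => ?_)
        · rw [Finset.mem_Ico] at hj
          rw [if_pos ⟨hi.1, hj.2⟩, mul_one]
        · rw [Finset.mem_Ico] at hj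
          by_cases h : a ≤ i ∧ j < c
          · rw [hz i j h.1 h.2 (by omega), zero_mul]
          · rw [if_neg h, mul_zero]
      · rw [Finset.mem_Ico] at hi
        refine Finset.sum_eq_zero fun j _ => ?_
        by_cases h : a ≤ i ∧ j < c
        · rw [hz i j h.1 h.2 (by omega), zero_mul]
        · rw [if_neg h, mul_zero]
    rw [EReal.toReal_coe, key, ← Finset.sum_add_distrib]
    refine Finset.sum_congr rfl fun i hi => ?_
    rw [← Finset.sum_add_distrib]
    refine Finset.sum_congr rfl fun j hj => ?_
    rw [Finset.mem_range] at hi hj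
    rw [aliveCount_cons, Nat.cast_add, mul_add, add_comm]
    congr 2
    simp only [EReal.coe_lt_coe_iff, hr.le_iff_le (mem_Iio.2 (hac.trans hcn)) (mem_Iio.2 hi),
      hr.lt_iff_lt (mem_Iio.2 hj) (mem_Iio.2 hcn), Nat.cast_ite, Nat.cast_one, Nat.cast_zero]

/-- By the last grid time all points have died. This disposes of the column `j = n - 1`, whose
second difference involves the value `r n` outside the grid. -/
theorem aliveCount_eq_zero {r : ℕ → ℝ} {n : ℕ} (hr : StrictMonoOn r (Iio n))
    {D : Multiset (ℝ × EReal)} (hD : ∀ z ∈ D, ∃ a c, a < c ∧ c < n ∧ z = (r a, (r c : EReal)))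
    {j : ℕ} (hj : j < n) (hjn : n ≤ j + 1) (s : ℝ) : aliveCount D s (r j) = 0 := by
  classical
  refine Multiset.countP_eq_zero.2 fun z hz h => ?_
  obtain ⟨a, c, -, hcn, rfl⟩ := hD z hz
  have := (hr.lt_iff_lt (mem_Iio.2 hj) (mem_Iio.2 hcn)).1 (EReal.coe_lt_coe_iff.1 h.2)
  omega

/-- A diagram is determined by its numbers of living points. -/
theorem eq_of_aliveCount_eq {r : ℕ → ℝ} {n : ℕ} (hr : StrictMonoOn r (Iio n))
    {D D' : Multiset (ℝ × EReal)}
    (hD : ∀ z ∈ D, ∃ a c, a < c ∧ c < n ∧ z = (r a, (r c : EReal)))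
    (hD' : ∀ z ∈ D', ∃ a c, a < c ∧ c < n ∧ z = (r a, (r c : EReal)))
    (h : ∀ i j, i ≤ j → j < n → aliveCount D (r i) (r j) = aliveCount D' (r i) (r j)) :
    D = D' := by
  classical
  -- A multiplicity is the sum of an indicator function over the diagram, so the summation formula
  -- expresses it through the counts.
  have hcount : ∀ (z : ℝ × EReal) (E : Multiset (ℝ × EReal)),
      (∀ z ∈ E, ∃ a c, a < c ∧ c < n ∧ z = (r a, (r c : EReal))) →
      (E.count z : ℝ) =
        (E.map fun y => if z = (y.1, (y.2.toReal : EReal)) then (1 : ℝ) else 0).sum := by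
    intro z E hE
    induction E using Multiset.induction with
    | empty => simp
    | cons y E ih =>
      obtain ⟨a, c, -, -, rfl⟩ := hE y (Multiset.mem_cons_self y E)
      rw [Multiset.count_cons, Multiset.map_cons, Multiset.sum_cons, Nat.cast_add,
        ih fun z hz => hE z (Multiset.mem_cons_of_mem hz), add_comm]
      congr 1
      rw [EReal.toReal_coe, Nat.cast_ite, Nat.cast_one, Nat.cast_zero]
  refine Multiset.ext.2 fun z => ?_
  have hG := sum_eq_sum_secondDifference
    (fun b d => if z = (b, (d : EReal)) then 1 else 0) hr
  rw [← Nat.cast_inj (R := ℝ), hcount z D hD, hcount z D' hD', hG D hD, hG D' hD']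
  refine Finset.sum_congr rfl fun i hi => Finset.sum_congr rfl fun j hj => ?_
  rcases lt_or_ge j i with hij | hij
  · rw [secondDifference_of_lt _ _ hij, zero_mul, zero_mul]
  · rw [h i j hij (Finset.mem_range.1 hj)]

end Telescoping

/-! ### Second differences of convex functions -/

section Convex

variable {f : ℝ → ℝ}

/-- Both `p' + h` and `p` are convex combinations of `p'` and `p + h`, with interchanged weights;
the two convexity inequalities add up. -/
theorem convexOn_add_le_add (hf : ConvexOn ℝ (Ici 0) f) {p p' h : ℝ} (hp' : 0 ≤ p')
    (hpp : p' < p) (hh : 0 < h) : f (p' + h) + f p ≤ f p' + f (p + h) := by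
  have hpos : 0 < p + h - p' := by linarith
  have hx : p' ∈ Ici (0 : ℝ) := hp'
  have hy : p + h ∈ Ici (0 : ℝ) := by rw [mem_Ici]; linarith
  have ha : 0 ≤ (p - p') / (p + h - p') := div_nonneg (by linarith) hpos.le
  have hb : 0 ≤ h / (p + h - p') := div_nonneg hh.le hpos.le
  have hab : (p - p') / (p + h - p') + h / (p + h - p') = 1 := by field_simp; ring
  have h1 := hf.2 hx hy ha hb hab
  have h2 := hf.2 hx hy hb ha (by rw [add_comm, hab])
  have e1 : (p - p') / (p + h - p') * p' + h / (p + h - p') * (p + h) = p' + h := by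
    field_simp; ring
  have e2 : h / (p + h - p') * p' + (p - p') / (p + h - p') * (p + h) = p := by
    field_simp; ring
  simp only [smul_eq_mul] at h1 h2
  rw [e1] at h1
  rw [e2] at h2
  generalize (p - p') / (p + h - p') = x at *
  generalize h / (p + h - p') = y at *
  obtain rfl : y = 1 - x := by linarith
  linarith

theorem strictConvexOn_add_lt_add (hf : StrictConvexOn ℝ (Ici 0) f) {p p' h : ℝ}
    (hp' : 0 ≤ p') (hpp : p' < p) (hh : 0 < h) : f (p' + h) + f p < f p' + f (p + h) := by
  have hpos : 0 < p + h - p' := by linarith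
  have hx : p' ∈ Ici (0 : ℝ) := hp'
  have hy : p + h ∈ Ici (0 : ℝ) := by rw [mem_Ici]; linarith
  have ha : 0 < (p - p') / (p + h - p') := div_pos (by linarith) hpos
  have hb : 0 < h / (p + h - p') := div_pos hh hpos
  have hab : (p - p') / (p + h - p') + h / (p + h - p') = 1 := by field_simp; ring
  have hne : p' ≠ p + h := by linarith
  have h1 := hf.2 hx hy hne ha hb hab
  have h2 := hf.2 hx hy hne hb ha (by rw [add_comm, hab])
  have e1 : (p - p') / (p + h - p') * p' + h / (p + h - p') * (p + h) = p' + h := by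
    field_simp; ring
  have e2 : h / (p + h - p') * p' + (p - p') / (p + h - p') * (p + h) = p := by
    field_simp; ring
  simp only [smul_eq_mul] at h1 h2
  rw [e1] at h1
  rw [e2] at h2
  generalize (p - p') / (p + h - p') = x at *
  generalize h / (p + h - p') = y at *
  obtain rfl : y = 1 - x := by linarith
  linarith

/-- For `j = i + 1` the convention of zero on the diagonal agrees with the formula only because `f 0
= 0`. -/
theorem secondDifference_sub (h0 : f 0 = 0) (r : ℕ → ℝ) {i j : ℕ} (hij : i < j) :
    secondDifference (fun b d => f (d - b)) r i j =
      (f (r (j + 1) - r i) - f (r j - r i)) -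
        (f (r (j + 1) - r (i + 1)) - f (r j - r (i + 1))) := by
  have h1 : i < j + 1 := by omega
  rcases (Nat.succ_le_of_lt hij).eq_or_lt with h | h
  · subst h
    simp [secondDifference, h0]
  · have h' : i + 1 < j := h
    simp [secondDifference, h1, hij, h']

variable {r : ℕ → ℝ} {n : ℕ}

theorem secondDifference_nonneg (hf : ConvexOn ℝ (Ici 0) f) (h0 : f 0 = 0)
    (hr : StrictMonoOn r (Iio n)) {i j : ℕ} (hij : i < j) (hj : j + 1 < n) :
    0 ≤ secondDifference (fun b d => f (d - b)) r i j := by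
  rw [secondDifference_sub h0 r hij]
  have h1 : r i < r (i + 1) := hr (by rw [mem_Iio]; omega) (by rw [mem_Iio]; omega) (by omega)
  have h2 : r j < r (j + 1) := hr (by rw [mem_Iio]; omega) (by rw [mem_Iio]; omega) (by omega)
  have h3 : r (i + 1) ≤ r j :=
    hr.monotoneOn (by rw [mem_Iio]; omega) (by rw [mem_Iio]; omega) (by omega)
  -- The increment of `f` over the length `r (j + 1) - r j` is larger from the later start `r j - r
  -- i` than from `r j - r (i + 1)`.
  have := convexOn_add_le_add hf (p := r j - r i) (p' := r j - r (i + 1))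
    (h := r (j + 1) - r j) (by linarith) (by linarith) (by linarith)
  rw [show r j - r (i + 1) + (r (j + 1) - r j) = r (j + 1) - r (i + 1) by ring,
    show r j - r i + (r (j + 1) - r j) = r (j + 1) - r i by ring] at this
  linarith

theorem secondDifference_pos (hf : StrictConvexOn ℝ (Ici 0) f) (h0 : f 0 = 0)
    (hr : StrictMonoOn r (Iio n)) {i j : ℕ} (hij : i < j) (hj : j + 1 < n) :
    0 < secondDifference (fun b d => f (d - b)) r i j := by
  rw [secondDifference_sub h0 r hij]
  have h1 : r i < r (i + 1) := hr (by rw [mem_Iio]; omega) (by rw [mem_Iio]; omega) (by omega)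
  have h2 : r j < r (j + 1) := hr (by rw [mem_Iio]; omega) (by rw [mem_Iio]; omega) (by omega)
  have h3 : r (i + 1) ≤ r j :=
    hr.monotoneOn (by rw [mem_Iio]; omega) (by rw [mem_Iio]; omega) (by omega)
  have := strictConvexOn_add_lt_add hf (p := r j - r i) (p' := r j - r (i + 1))
    (h := r (j + 1) - r j) (by linarith) (by linarith) (by linarith)
  rw [show r j - r (i + 1) + (r (j + 1) - r j) = r (j + 1) - r (i + 1) by ring,
    show r j - r i + (r (j + 1) - r j) = r (j + 1) - r i by ring] at this
  linarith

end Convex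

/-! ### Comparison of diagrams through their counts -/

section Comparison

/-- All points of the diagram have coordinates in `T` and lie above the diagonal. -/
def IsFiniteDiagramIn (T : Set ℝ) (D : Multiset (ℝ × EReal)) : Prop :=
  ∀ z ∈ D, z.1 ∈ T ∧ (∃ x ∈ T, z.2 = (x : EReal)) ∧ (z.1 : EReal) < z.2

variable {T : Set ℝ} {D D' : Multiset (ℝ × EReal)}

theorem exists_grid (hD : IsFiniteDiagramIn T D) : ∃ (r : ℕ → ℝ) (n : ℕ),
    StrictMonoOn r (Iio n) ∧ (∀ i < n, r i ∈ T) ∧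
      ∀ z ∈ D, ∃ a c, a < c ∧ c < n ∧ z = (r a, (r c : EReal)) := by
  classical
  let P : Finset ℝ := D.toFinset.image Prod.fst ∪ D.toFinset.image fun z => z.2.toReal
  have hP : ∀ x ∈ P, x ∈ T := by
    intro x hx
    rcases Finset.mem_union.1 hx with h | h
    · obtain ⟨z, hz, rfl⟩ := Finset.mem_image.1 h
      exact (hD z (Multiset.mem_toFinset.1 hz)).1
    · obtain ⟨z, hz, rfl⟩ := Finset.mem_image.1 h
      obtain ⟨y, hy, h⟩ := (hD z (Multiset.mem_toFinset.1 hz)).2.1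
      rw [h]
      exact hy
  let r : ℕ → ℝ := fun i => if h : i < P.card then P.orderEmbOfFin rfl ⟨i, h⟩ else 0
  have hr : ∀ i (h : i < P.card), r i = P.orderEmbOfFin rfl ⟨i, h⟩ := fun i h => dif_pos h
  have hmono : StrictMonoOn r (Iio P.card) := by
    intro i hi j hj hij
    rw [hr i hi, hr j hj]
    exact (P.orderEmbOfFin rfl).strictMono hij
  have hsurj : ∀ x ∈ P, ∃ i < P.card, r i = x := by
    intro x hx
    have : x ∈ Set.range (P.orderEmbOfFin rfl) := by
      rw [Finset.range_orderEmbOfFin]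
      exact hx
    obtain ⟨i, hi⟩ := this
    exact ⟨i, i.2, (hr i i.2).trans hi⟩
  refine ⟨r, P.card, hmono, fun i hi => ?_, fun z hz => ?_⟩
  · rw [hr i hi]
    exact hP _ (P.orderEmbOfFin_mem rfl _)
  · obtain ⟨-, ⟨x, -, hx⟩, hlt⟩ := hD z hz
    obtain ⟨a, ha, hra⟩ := hsurj z.1 (Finset.mem_union_left _
      (Finset.mem_image_of_mem _ (Multiset.mem_toFinset.2 hz)))
    obtain ⟨c, hc, hrc⟩ := hsurj z.2.toReal (Finset.mem_union_right _
      (Finset.mem_image_of_mem (fun z : ℝ × EReal => z.2.toReal) (Multiset.mem_toFinset.2 hz)))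
    have hz2 : z.2 = (r c : EReal) := by rw [hrc, hx, EReal.toReal_coe]
    refine ⟨a, c, ?_, hc, Prod.ext hra.symm hz2⟩
    rw [hz2, ← hra, EReal.coe_lt_coe_iff] at hlt
    exact (hmono.lt_iff_lt ha hc).1 hlt

variable (hD : IsFiniteDiagramIn T D) (hD' : IsFiniteDiagramIn T D')
  (hle : ∀ s ∈ T, ∀ t ∈ T, s ≤ t → aliveCount D' s t ≤ aliveCount D s t)
  (hdiag : ∀ t ∈ T, aliveCount D' t t = aliveCount D t t) {f : ℝ → ℝ} (h0 : f 0 = 0)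

include hD hD' hle hdiag h0

/-- If two diagrams have the same number of living points at each time and the points of the
first live longer, then its lifetimes have a larger sum of values of a convex function. -/
theorem lifetimeSum_le_and_eq (hf : ConvexOn ℝ (Ici 0) f) :
    lifetimeSum f D' ≤ lifetimeSum f D ∧
      (StrictConvexOn ℝ (Ici 0) f → lifetimeSum f D' = lifetimeSum f D → D = D') := by
  -- Using `D + D'` gives one grid for both diagrams, so that the coefficients coincide. The grid
  -- lies in `T`, where the counts are comparable.
  obtain ⟨r, n, hr, hrT, hgrid⟩ := exists_grid (T := T) (D := D + D') fun z hz =>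
    (Multiset.mem_add.1 hz).elim (hD z) (hD' z)
  have hgD := fun z hz => hgrid z (Multiset.mem_add.2 (Or.inl hz))
  have hgD' := fun z hz => hgrid z (Multiset.mem_add.2 (Or.inr hz))
  have hsum := sum_eq_sum_secondDifference (fun b d => f (d - b)) hr D hgD
  have hsum' := sum_eq_sum_secondDifference (fun b d => f (d - b)) hr D' hgD'
  have hterm : ∀ i ∈ Finset.range n, ∀ j ∈ Finset.range n,
      secondDifference (fun b d => f (d - b)) r i j * aliveCount D' (r i) (r j) ≤
        secondDifference (fun b d => f (d - b)) r i j * aliveCount D (r i) (r j) := by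
    intro i hi j hj
    rw [Finset.mem_range] at hi hj
    rcases lt_trichotomy i j with hij | rfl | hij
    · by_cases hjn : j + 1 < n
      · exact mul_le_mul_of_nonneg_left (Nat.cast_le.2 (hle _ (hrT i hi) _ (hrT j hj)
          (hr.monotoneOn hi hj hij.le))) (secondDifference_nonneg hf h0 hr hij hjn)
      · rw [aliveCount_eq_zero hr hgD hj (not_lt.1 hjn),
          aliveCount_eq_zero hr hgD' hj (not_lt.1 hjn)]
    · rw [hdiag _ (hrT i hi)]
    · rw [secondDifference_of_lt _ _ hij, zero_mul, zero_mul]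
  refine ⟨?_, fun hsf heq => ?_⟩
  · rw [lifetimeSum, lifetimeSum, hsum, hsum']
    exact Finset.sum_le_sum fun i hi => Finset.sum_le_sum fun j hj => hterm i hi j hj
  · rw [lifetimeSum, lifetimeSum, hsum, hsum'] at heq
    -- Equal sums with termwise inequality have equal terms; positive coefficients above the
    -- diagonal can then be cancelled.
    have h1 := (Finset.sum_eq_sum_iff_of_le fun i hi =>
      Finset.sum_le_sum fun j hj => hterm i hi j hj).1 heq
    refine eq_of_aliveCount_eq hr hgD hgD' fun i j hij hj => ?_
    have hi := hij.trans_lt hj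
    have h2 := (Finset.sum_eq_sum_iff_of_le fun j hj => hterm i (Finset.mem_range.2 hi) j hj).1
      (h1 i (Finset.mem_range.2 hi)) j (Finset.mem_range.2 hj)
    rcases hij.eq_or_lt with rfl | hij
    · exact (hdiag _ (hrT i hi)).symm
    · by_cases hjn : j + 1 < n
      · exact (Nat.cast_injective
          (mul_left_cancel₀ (secondDifference_pos hsf h0 hr hij hjn).ne' h2)).symm
      · rw [aliveCount_eq_zero hr hgD hj (not_lt.1 hjn),
          aliveCount_eq_zero hr hgD' hj (not_lt.1 hjn)]

end Comparison

/-! ### Wasserstein distance to the empty diagram -/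

section Wasserstein

variable {T : Set ℝ} {D : Multiset (ℝ × EReal)} {r : ℝ}

theorem ennreal_ofReal_multiset_sum {α : Type*} (g : α → ℝ) (D : Multiset α)
    (hg : ∀ z ∈ D, 0 ≤ g z) :
    (D.map fun z => ENNReal.ofReal (g z)).sum = ENNReal.ofReal (D.map g).sum := by
  induction D using Multiset.induction with
  | empty => simp
  | cons z D ih =>
    have hD : ∀ z ∈ D, 0 ≤ g z := fun z hz => hg z (Multiset.mem_cons_of_mem hz)
    rw [Multiset.map_cons, Multiset.sum_cons, Multiset.map_cons, Multiset.sum_cons, ih hD,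
      ENNReal.ofReal_add (hg z (Multiset.mem_cons_self z D))]
    exact Multiset.sum_nonneg fun x hx => by
      obtain ⟨y, hy, rfl⟩ := Multiset.mem_map.1 hx
      exact hD y hy

theorem abs_sub_coe (x y : ℝ) : ((x : EReal) - (y : EReal)).abs = ENNReal.ofReal |x - y| := by
  rw [← EReal.coe_sub, EReal.abs_def]

theorem pairDist_coe (b d b' d' : ℝ) : pairDist (b, (d : EReal)) (b', (d' : EReal)) =
    ENNReal.ofReal (max |b - b'| |d - d'|) := by
  rw [pairDist, ENNReal.ofReal_max]
  congr 1
  split_ifs with h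
  · rw [EReal.coe_eq_coe_iff.1 h, sub_self, abs_zero, ENNReal.ofReal_zero]
  · exact abs_sub_coe d d'

/-- The distance to the empty diagram is at most the one given by the matching of all points with
the nearest points of the diagonal. -/
theorem wassersteinDist_zero_le (hD : IsFiniteDiagramIn T D) (hr : 0 < r) :
    wassersteinDist r D 0 ≤
      (ENNReal.ofReal (lifetimeSum (fun x => (x / 2) ^ r) D)) ^ (1 / r) := by
  -- The midpoint gives a nearest diagonal point, at `ℓ^∞`-distance `(d - b) / 2`.
  let mid : ℝ × EReal → ℝ := fun z => (z.1 + z.2.toReal) / 2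
  let γ : Multiset ((ℝ × EReal) × (ℝ × EReal)) := D.map fun z => (z, (mid z, (mid z : EReal)))
  have hγ : IsMatching D 0 γ := by
    refine ⟨0, D.map mid, ?_, ?_⟩
    · rw [Multiset.map_map, Multiset.map_zero, add_zero]
      exact Multiset.map_id _
    · rw [Multiset.map_map, Multiset.map_map, zero_add]
      rfl
  refine (iInf₂_le γ hγ).trans ?_
  rw [lifetimeSum, ← ennreal_ofReal_multiset_sum, Multiset.map_map]
  · refine le_of_eq (congrArg (fun x : ℝ≥0∞ => x ^ (1 / r)) (congrArg Multiset.sum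
      (Multiset.map_congr rfl fun z hz => ?_)))
    obtain ⟨-, ⟨x, -, hx⟩, hlt⟩ := hD z hz
    obtain ⟨b, d⟩ := z
    change d = (x : EReal) at hx
    subst hx
    have hbx : b < x := EReal.coe_lt_coe_iff.1 hlt
    change pairDist (b, (x : EReal)) ((b + x) / 2, (((b + x) / 2 : ℝ) : EReal)) ^ r =
      ENNReal.ofReal (((x - b) / 2) ^ r)
    rw [pairDist_coe, show b - (b + x) / 2 = -((x - b) / 2) by ring,
      show x - (b + x) / 2 = (x - b) / 2 by ring, abs_neg, max_self,
      abs_of_nonneg (by linarith), ENNReal.ofReal_rpow_of_nonneg (by linarith) hr.le]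
  · intro z hz
    obtain ⟨-, ⟨x, -, hx⟩, hlt⟩ := hD z hz
    rw [hx, EReal.coe_lt_coe_iff] at hlt
    rw [hx, EReal.toReal_coe]
    exact Real.rpow_nonneg (by linarith) r

/-- The distance to the empty diagram is at least the one given by the distances to the diagonal. -/
theorem le_wassersteinDist_zero (hD : IsFiniteDiagramIn T D) (hr : 0 < r) :
    (ENNReal.ofReal (lifetimeSum (fun x => (x / 2) ^ r) D)) ^ (1 / r) ≤
      wassersteinDist r D 0 := by
  refine le_iInf₂ fun γ hγ => ENNReal.rpow_le_rpow ?_ (by positivity)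
  obtain ⟨A, B, hA, hB⟩ := hγ
  -- `c` is the `r`-th power of the distance to the diagonal. It vanishes on the added diagonal
  -- points, and every pair of `γ` costs at least `c` of its first entry, as the second is diagonal.
  let c : ℝ × EReal → ℝ := fun z => ((z.2.toReal - z.1) / 2) ^ r
  have hfin : ∀ z ∈ γ.map Prod.fst, ∃ b d : ℝ, b ≤ d ∧ z = (b, (d : EReal)) := by
    intro z hz
    rw [hA] at hz
    rcases Multiset.mem_add.1 hz with h | h
    · obtain ⟨-, ⟨x, -, hx⟩, hlt⟩ := hD z h
      refine ⟨z.1, x, ?_, Prod.ext rfl hx⟩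
      rw [hx, EReal.coe_lt_coe_iff] at hlt
      exact hlt.le
    · obtain ⟨a, -, rfl⟩ := Multiset.mem_map.1 h
      exact ⟨a, a, le_rfl, rfl⟩
  have hsum : lifetimeSum (fun x => (x / 2) ^ r) D = (γ.map fun z => c z.1).sum := by
    have h : γ.map (fun z => c z.1) = (γ.map Prod.fst).map c := by
      rw [Multiset.map_map]
      rfl
    rw [h, hA, Multiset.map_add, Multiset.sum_add, Multiset.map_map]
    have h0 : (A.map (c ∘ fun a : ℝ => ((a, (a : EReal)) : ℝ × EReal))).sum = 0 := by
      refine Multiset.sum_eq_zero fun x hx => ?_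
      obtain ⟨a, -, rfl⟩ := Multiset.mem_map.1 hx
      change (((a : EReal).toReal - a) / 2) ^ r = 0
      rw [EReal.toReal_coe, sub_self, zero_div, Real.zero_rpow hr.ne']
    rw [h0, add_zero]
    rfl
  rw [hsum, ← ennreal_ofReal_multiset_sum]
  · refine Multiset.sum_map_le_sum_map _ _ fun z hz => ?_
    obtain ⟨b, d, hbd, hz1⟩ := hfin z.1 (Multiset.mem_map_of_mem _ hz)
    have hz2 : z.2 ∈ γ.map Prod.snd := Multiset.mem_map_of_mem _ hz
    rw [hB, zero_add] at hz2
    obtain ⟨a, -, ha⟩ := Multiset.mem_map.1 hz2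
    rw [hz1, ← ha, pairDist_coe]
    change ENNReal.ofReal ((((d : EReal).toReal - b) / 2) ^ r) ≤ _
    rw [EReal.toReal_coe, ← ENNReal.ofReal_rpow_of_nonneg (by linarith) hr.le]
    refine ENNReal.rpow_le_rpow (ENNReal.ofReal_le_ofReal ?_) hr.le
    have h1 := le_max_left |b - a| |d - a|
    have h2 := le_max_right |b - a| |d - a|
    have h3 := neg_abs_le (b - a)
    have h4 := le_abs_self (d - a)
    linarith
  · intro z hz
    obtain ⟨b, d, hbd, hz1⟩ := hfin z.1 (Multiset.mem_map_of_mem _ hz)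
    change 0 ≤ ((z.1.2.toReal - z.1.1) / 2) ^ r
    rw [hz1]
    change 0 ≤ (((d : EReal).toReal - b) / 2) ^ r
    rw [EReal.toReal_coe]
    exact Real.rpow_nonneg (by linarith) r

theorem convexOn_half_rpow (hr : 1 < r) : ConvexOn ℝ (Ici 0) fun x : ℝ => (x / 2) ^ r := by
  have h : ConvexOn ℝ (Ici 0) fun x : ℝ => (1 / 2 : ℝ) ^ r • x ^ r :=
    (convexOn_rpow hr.le).smul (by positivity)
  refine h.congr fun x hx => ?_
  change (1 / 2 : ℝ) ^ r * x ^ r = (x / 2) ^ r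
  rw [← Real.mul_rpow (by norm_num) hx]
  congr 1
  ring

end Wasserstein

/-! ### Critical times of the filtration -/

section Filtration

variable {T : Set ℝ} {Y : Type u} [TopologicalSpace Y]

/-- Beyond all critical values, or at the last time `N`, the filtration no longer changes and has
exhausted its union. -/
theorem FiniteFiltration.exists_space_eq_total (hT : IsTimeSet T) (X : FiniteFiltration T Y) :
    ∃ t₀ : T, ∀ t : T, t₀ ≤ t → X.space t = X.total := by
  suffices h : ∃ t₀ : T, ∀ s t : T, t₀ ≤ s → s ≤ t → X.space s = X.space t by
    obtain ⟨t₀, h⟩ := h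
    refine ⟨t₀, fun t ht => (Set.subset_iUnion _ t).antisymm (Set.iUnion_subset fun s => ?_)⟩
    exact (X.mono (le_max_right t s)).trans (h t (max t s) ht (le_max_left t s)).ge
  rcases hT with rfl | ⟨N, rfl⟩
  · obtain ⟨S, hS⟩ := X.step
    obtain ⟨M, hM⟩ := S.bddAbove
    refine ⟨⟨max M 0, mem_Ici.2 (le_max_right _ _)⟩, fun s t hs hst =>
      hS s t hst fun c hc hsc => ?_⟩
    have h1 : max M 0 ≤ (s : ℝ) := hs
    have h2 := le_max_left M 0
    have h3 := hM hc
    linarith [hsc.1]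
  · refine ⟨⟨N, N, le_rfl, rfl⟩, fun s t hs hst => ?_⟩
    congr 1
    refine hst.antisymm (le_trans ?_ hs)
    obtain ⟨-, n, hn, rfl⟩ := t
    exact Subtype.mk_le_mk.2 (Nat.cast_le.2 hn)

/-- There are finitely many times such that each time has a preceding one among them from which on
the filtration has been constant. -/
theorem FiniteFiltration.exists_critical (hT : IsTimeSet T) (X : FiniteFiltration T Y) :
    ∃ R : Finset T, ∀ t : T, ∃ c ∈ R, c ≤ t ∧ (∀ c' ∈ R, c' ≤ t → c' ≤ c) ∧
      X.space c = X.space t := by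
  classical
  rcases hT with rfl | ⟨N, rfl⟩
  · obtain ⟨S, hS⟩ := X.step
    -- Inserting `0` ensures that each time is preceded by an element of `R`.
    let R : Finset (Ici (0 : ℝ)) := insert ⟨0, mem_Ici.2 le_rfl⟩ (S.subtype (· ∈ Ici (0 : ℝ)))
    refine ⟨R, fun t => ?_⟩
    have hne : (R.filter (· ≤ t)).Nonempty :=
      ⟨⟨0, mem_Ici.2 le_rfl⟩, Finset.mem_filter.2 ⟨Finset.mem_insert_self _ _, t.2⟩⟩
    obtain ⟨c, hc, hmax⟩ := (R.filter (· ≤ t)).exists_max_image id hne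
    rw [Finset.mem_filter] at hc
    have hmax' : ∀ c' ∈ R, c' ≤ t → c' ≤ c := fun c' h h' => hmax c' (Finset.mem_filter.2 ⟨h, h'⟩)
    refine ⟨c, hc.1, hc.2, hmax', hS c t hc.2 fun x hx hxt => ?_⟩
    have hx0 : (0 : ℝ) ≤ x := le_trans c.2 hxt.1.le
    have := hmax' ⟨x, hx0⟩ (Finset.mem_insert_of_mem (Finset.mem_subtype.2 hx)) hxt.2
    exact absurd hxt.1 (not_lt.2 this)
  · have : Finite {x : ℝ | ∃ n : ℕ, n ≤ N ∧ x = (n : ℝ)} := by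
      refine ((Set.finite_Iic N).image (fun n : ℕ => (n : ℝ))).subset ?_
      rintro _ ⟨n, hn, rfl⟩
      exact ⟨n, hn, rfl⟩
    have := Fintype.ofFinite {x : ℝ | ∃ n : ℕ, n ≤ N ∧ x = (n : ℝ)}
    exact ⟨Finset.univ, fun t => ⟨t, Finset.mem_univ _, le_rfl, fun _ _ h => h, rfl⟩⟩

theorem bijective_persistentHomology_of_space_eq (X : FiniteFiltration T Y) (k : Type) [Field k]
    (q : ℕ) {s t : T} (hst : s ≤ t) (h : X.space s = X.space t) :
    Function.Bijective (transition (persistentHomology X k q) s t) := by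
  rw [transition_of_le _ hst]
  have : IsIso (X.toFunctor.map (homOfLE hst)) := by
    refine ⟨TopCat.ofHom ⟨Set.inclusion h.ge, continuous_inclusion _⟩, ?_, ?_⟩ <;> rfl
  have : IsIso ((persistentHomology X k q).map (homOfLE hst)) := by
    change IsIso ((singularHomology k q).map (X.toFunctor.map (homOfLE hst)))
    infer_instance
  exact ConcreteCategory.bijective_of_isIso ((persistentHomology X k q).map (homOfLE hst))

end Filtration

/-! ### Universal coefficients for persistent homology and its diagrams -/

section FiniteFiltration

variable {T : Set ℝ} {Y : Type u} [TopologicalSpace Y] {X : FiniteFiltration T Y} {q : ℕ}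
  (hfree : ∀ m : ℕ, m + 1 = q →
    ∀ t : T, Module.Free ℤ ((singularHomology ℤ m).obj (TopCat.of (X.space t))))
  (k : Type) [Field k]

/-- The persistent homology over a field by extension of scalars, at one time. -/
noncomputable def persistentHomologyEquiv (t : T) : (persistentHomology X k q).obj t ≃ₗ[k]
    k ⊗[ℤ] ((persistentHomology X ℤ q).obj t : Type u) :=
  haveI := preservesLeftHomologyOf_singularChains ℤ k q (TopCat.of (X.space t))
    fun m hm => hfree m hm t
  (singularHomologyBaseChange ℤ k q (TopCat.of (X.space t))).toLinearEquiv ≪≫ₗ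
    baseChangeEquiv ℤ k _

theorem persistentHomologyEquiv_map {s t : T} (hst : s ≤ t)
    (v : (persistentHomology X k q).obj s) :
    persistentHomologyEquiv hfree k t ((persistentHomology X k q).map (homOfLE hst) v) =
      ((persistentHomology X ℤ q).map (homOfLE hst)).hom.baseChange k
        (persistentHomologyEquiv hfree k s v) := by
  have hs := preservesLeftHomologyOf_singularChains ℤ k q (TopCat.of (X.space s))
    fun m hm => hfree m hm s
  have ht := preservesLeftHomologyOf_singularChains ℤ k q (TopCat.of (X.space t))
    fun m hm => hfree m hm t
  have h := congrArg (fun f => f.hom v)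
    (singularHomologyBaseChange_naturality ℤ k q (A := TopCat.of (X.space s))
      (B := TopCat.of (X.space t)) (X.toFunctor.map (homOfLE hst)))
  exact (congrArg (baseChangeEquiv ℤ k _) h).trans (baseChangeEquiv_map ℤ k _ _)

include hfree in
/-- The ranks of the maps of persistent homology over a field are those of the extensions of
scalars of the integral maps. -/
theorem finrank_range_persistentHomology {s t : T} (hst : s ≤ t) :
    Module.finrank k (LinearMap.range ((persistentHomology X k q).map (homOfLE hst)).hom) =
      Module.finrank k (LinearMap.range
        (((persistentHomology X ℤ q).map (homOfLE hst)).hom.baseChange k)) := by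
  have h : (persistentHomologyEquiv hfree k t).toLinearMap ∘ₗ
      ((persistentHomology X k q).map (homOfLE hst)).hom =
      ((persistentHomology X ℤ q).map (homOfLE hst)).hom.baseChange k ∘ₗ
        (persistentHomologyEquiv hfree k s).toLinearMap :=
    LinearMap.ext fun v => persistentHomologyEquiv_map hfree k hst v
  rw [← LinearEquiv.finrank_map_eq (persistentHomologyEquiv hfree k t), ← LinearMap.range_comp, h,
    LinearMap.range_comp, LinearEquiv.range, LinearMap.range_eq_map]

include hfree in
theorem finite_persistentHomology_iff (t : T)
    (hfree' : Module.Free ℤ ((persistentHomology X ℤ q).obj t)) :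
    Module.Finite k ((persistentHomology X k q).obj t) ↔
      Module.Finite ℤ ((persistentHomology X ℤ q).obj t) := by
  constructor
  · intro h
    have := Module.Finite.equiv (persistentHomologyEquiv hfree k t)
    exact finite_of_finite_baseChange (k := k)
  · intro h
    exact Module.Finite.equiv (persistentHomologyEquiv hfree k t).symm

variable {k} in
theorem isDiagramOf_diagramOf {V : T ⥤ ModuleCat.{u} k} (h : ∃ D, IsDiagramOf V D) :
    IsDiagramOf V (diagramOf V) := by
  rw [diagramOf, dif_pos h]
  exact h.choose_spec

include hfree in
/-- Persistent homology has a persistence diagram if it is finitely generated over the integers. -/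
theorem isDiagramOf_persistenceDiagram (hT : IsTimeSet T)
    (hfree' : ∀ t : T, Module.Free ℤ ((persistentHomology X ℤ q).obj t))
    (hfin : ∀ t : T, Module.Finite ℤ ((persistentHomology X ℤ q).obj t)) :
    IsDiagramOf (persistentHomology X k q) (persistenceDiagram X k q) := by
  have (t : T) : Module.Finite k ((persistentHomology X k q).obj t) :=
    (finite_persistentHomology_iff hfree k t (hfree' t)).2 (hfin t)
  obtain ⟨R, hR⟩ := X.exists_critical hT
  refine isDiagramOf_diagramOf (exists_isDiagramOf _ R fun t => ?_)
  obtain ⟨c, hc, hct, hmax, h⟩ := hR t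
  exact ⟨c, hc, hct, hmax, bijective_persistentHomology_of_space_eq X k q hct h⟩

include hfree in
/-- Persistent homology that is free over the integers has no persistence diagram with finitely many
points if it is not finitely generated. -/
theorem persistenceDiagram_eq_zero
    (hfree' : ∀ t : T, Module.Free ℤ ((persistentHomology X ℤ q).obj t))
    (hfin : ¬ ∀ t : T, Module.Finite ℤ ((persistentHomology X ℤ q).obj t)) :
    persistenceDiagram X k q = 0 :=
  dif_neg fun ⟨_, hD⟩ => hfin fun t =>
    (finite_persistentHomology_iff hfree k t (hfree' t)).1 (hD.finite t)

-- A point with infinite death time would be alive at a late time `t` with `X_t = X`, where the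
-- homology over `k` is `k ⊗ 0 = 0`.
include hfree in
theorem isFiniteDiagramIn_persistenceDiagram (hT : IsTimeSet T)
    (hfree' : ∀ t : T, Module.Free ℤ ((persistentHomology X ℤ q).obj t))
    (htotal : Subsingleton ((singularHomology ℤ q).obj (TopCat.of X.total)))
    (hfin : ∀ t : T, Module.Finite ℤ ((persistentHomology X ℤ q).obj t)) :
    IsFiniteDiagramIn T (persistenceDiagram X k q) := by
  have hD := isDiagramOf_persistenceDiagram hfree k hT hfree' hfin
  obtain ⟨t₀, ht₀⟩ := X.exists_space_eq_total hT
  intro z hz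
  obtain ⟨hb, hd, hbd⟩ := hD.mem hz
  refine ⟨hb, hd.resolve_left fun hd => ?_, hbd⟩
  let t : T := max t₀ ⟨z.1, hb⟩
  have hsub : Subsingleton ((persistentHomology X ℤ q).obj t) := by
    change Subsingleton ((singularHomology ℤ q).obj (TopCat.of (X.space t)))
    rw [ht₀ t (le_max_left _ _)]
    exact htotal
  have hsub' : Subsingleton ((persistentHomology X k q).obj t) :=
    (persistentHomologyEquiv hfree k t).toEquiv.subsingleton
  have h0 := hD.finrank_eq t
  rw [Module.finrank_zero_of_subsingleton] at h0
  have hbt : z.1 ≤ (t : ℝ) := Subtype.coe_le_coe.2 (le_max_right t₀ ⟨z.1, hb⟩)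
  refine Multiset.countP_eq_zero.1 h0.symm z hz ⟨hbt, ?_⟩
  rw [hd]
  exact EReal.coe_lt_top _

end FiniteFiltration

end PersistentHomology

/-! ### The main theorem -/

open PersistentHomology in
theorem theorem4 {T : Set ℝ} (hT : IsTimeSet T)
    {Y : Type*} [TopologicalSpace Y] [T2Space Y] (X : FiniteFiltration T Y) (q : ℕ)
    (hfree : ∀ t : T, Module.Free ℤ ((singularHomology ℤ q).obj (TopCat.of (X.space t))))
    (hfree' : ∀ m : ℕ, m + 1 = q →
      ∀ t : T, Module.Free ℤ ((singularHomology ℤ m).obj (TopCat.of (X.space t))))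
    (htotal : Subsingleton ((singularHomology ℤ q).obj (TopCat.of X.total)))
    (p : ℕ) [Fact p.Prime] :
    (∀ z ∈ persistenceDiagram X ℝ q, z.2 ≠ ⊤) ∧
    (∀ z ∈ persistenceDiagram X (ZMod p) q, z.2 ≠ ⊤) ∧
    (∀ f : ℝ → ℝ, ContDiffOn ℝ 2 f (Set.Ici 0) → ConvexOn ℝ (Set.Ici 0) f → f 0 = 0 →
      lifetimeSum f (persistenceDiagram X ℝ q) ≥
          lifetimeSum f (persistenceDiagram X (ZMod p) q) ∧
        (StrictConvexOn ℝ (Set.Ici 0) f →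
          (lifetimeSum f (persistenceDiagram X ℝ q) =
              lifetimeSum f (persistenceDiagram X (ZMod p) q) ↔
            persistenceDiagram X ℝ q = persistenceDiagram X (ZMod p) q))) ∧
    (∀ r : ℝ, 1 < r →
      wassersteinDist r (persistenceDiagram X ℝ q) 0 ≥
        wassersteinDist r (persistenceDiagram X (ZMod p) q) 0) := by
  by_cases hfin : ∀ t : T, Module.Finite ℤ ((persistentHomology X ℤ q).obj t)
  · have hD := isDiagramOf_persistenceDiagram hfree' ℝ hT hfree hfin
    have hD' := isDiagramOf_persistenceDiagram hfree' (ZMod p) hT hfree hfin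
    have hF := isFiniteDiagramIn_persistenceDiagram hfree' ℝ hT hfree htotal hfin
    have hF' := isFiniteDiagramIn_persistenceDiagram hfree' (ZMod p) hT hfree htotal hfin
    have hle : ∀ s ∈ T, ∀ t ∈ T, s ≤ t → aliveCount (persistenceDiagram X (ZMod p) q) s t ≤
        aliveCount (persistenceDiagram X ℝ q) s t := by
      intro s hs t ht hst
      have hst' : (⟨s, hs⟩ : T) ≤ ⟨t, ht⟩ := hst
      have : Module.Free ℤ ((persistentHomology X ℤ q).obj ⟨t, ht⟩) := hfree ⟨t, ht⟩
      have := hfin ⟨t, ht⟩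
      -- Both counts are ranks of base changes of one integral map; `ℝ` is flat over `ℤ`, so its
      -- side is the integral rank, which bounds the other.
      rw [← hD.finrank_range hst', ← hD'.finrank_range hst',
        finrank_range_persistentHomology hfree', finrank_range_persistentHomology hfree',
        finrank_range_baseChange_of_flat ℝ]
      exact finrank_range_baseChange_le _ _
    have hdiag : ∀ t ∈ T, aliveCount (persistenceDiagram X (ZMod p) q) t t =
        aliveCount (persistenceDiagram X ℝ q) t t := by
      intro t ht
      have : Module.Free ℤ ((persistentHomology X ℤ q).obj ⟨t, ht⟩) := hfree ⟨t, ht⟩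
      have h := hD.finrank_eq ⟨t, ht⟩
      have h' := hD'.finrank_eq ⟨t, ht⟩
      rw [(persistentHomologyEquiv hfree' _ _).finrank_eq, Module.finrank_baseChange] at h h'
      exact h'.symm.trans h
    have hne : ∀ {D : Multiset (ℝ × EReal)}, IsFiniteDiagramIn T D → ∀ z ∈ D, z.2 ≠ ⊤ := by
      intro D hD z hz h
      obtain ⟨x, -, hx⟩ := (hD z hz).2.1
      exact EReal.coe_ne_top x (hx.symm.trans h)
    refine ⟨hne hF, hne hF', fun f _ hf h0 => ?_, fun r hr => ?_⟩
    · have h := lifetimeSum_le_and_eq hF hF' hle hdiag h0 hf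
      exact ⟨h.1, fun hs => ⟨fun heq => h.2 hs heq.symm, fun heq => by rw [heq]⟩⟩
    · have hr0 : 0 < r := by linarith
      have h := (lifetimeSum_le_and_eq hF hF' hle hdiag (f := fun x => (x / 2) ^ r)
        (by rw [zero_div, Real.zero_rpow hr0.ne']) (convexOn_half_rpow hr)).1
      exact (wassersteinDist_zero_le hF' hr0).trans ((ENNReal.rpow_le_rpow
        (ENNReal.ofReal_le_ofReal h) (by positivity)).trans (le_wassersteinDist_zero hF hr0))
  -- Without finite generation both diagrams take the default value `0`.
  · have hD := persistenceDiagram_eq_zero hfree' ℝ hfree hfin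
    have hD' := persistenceDiagram_eq_zero hfree' (ZMod p) hfree hfin
    rw [hD, hD']
    exact ⟨by simp, by simp, fun f _ _ _ => ⟨le_rfl, fun _ => iff_of_true rfl rfl⟩,
      fun r _ => le_rfl⟩
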